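/- **Conventions.** All Hilbert spaces are complex and $\mathbb D=\{\lambda\in\mathbb C:|\lambda|<1\}$; subspaces are closed. For a contraction $T\in\mathbf L(H_1,H_2)$ put $D_T=(I-T^*T)^{1/2}$ and $\mathfrak D_T=\overline{\operatorname{ran}}\,D_T\subset H_1$ (so $D_{T^*}=(I-TT^*)^{1/2}$, $\mathfrak D_{T^*}\subset H_2$), and let $$\mathbf J_T=\begin{bmatrix}T&D_{T^*}\\ D_T&-T^*\end{bmatrix}:H_1\oplus\mathfrak D_{T^*}\to H_2\oplus\mathfrak D_T .$$ The Schur class $\mathbf S(H_1,H_2)$ is the set of holomorphic functions $\mathbb D\to\mathbf L(H_1,H_2)$ with contractive values. For $\Theta\in\mathbf S(H_1,H_2)$ with $T=\Theta(0)$, its Möbius parameter is the function $Z\in\mathbf S(\mathfrak D_T,\mathfrak D_{T^*})$ with $Z(0)=0$ and $\Theta(\lambda)=T+D_{T^*}Z(\lambda)(I+T^*Z(\lambda))^{-1}D_T$ for $\lambda\in\mathbb D$. The Schur iterates of $\Theta$ are $\Theta_0=\Theta$ and $\Theta_{n+1}(\lambda)=Z_n(\lambda)/\lambda$, where $Z_n$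 is the Möbius parameter of $\Theta_n$; the Schur parameters of $\Theta$ are $\Gamma_n=\Theta_n(0)$, $n\ge0$. Thus $\Gamma_0\in\mathbf L(H_1,H_2)$ and $\Gamma_n\in\mathbf L(\mathfrak D_{\Gamma_{n-1}},\mathfrak D_{\Gamma_{n-1}^*})$ for $n\ge1$ (some of these spaces may be $\{0\}$; once $\Gamma_m$ is unitary, all later spaces are $\{0\}$). For such a sequence of contractions $\{\Gamma_n\}_{n\ge0}$ with $H_1=H_2=\mathfrak M$ let $$\mathfrak H_0=\bigoplus_{n\ge0}\bigl(\mathfrak D_{\Gamma_{2n}}\oplus\mathfrak D_{\Gamma_{2n+1}^*}\bigr),\qquad \widetilde{\mathfrak H}_0=\bigoplus_{n\ge0}\bigl(\mathfrak D_{\Gamma_{2n}^*}\oplus\mathfrak D_{\Gamma_{2n+1}}\bigr),$$ $$\mathcal M_0=I_{\mathfrak M}\oplus\bigoplus_{n\ge1}\mathbf J_{\Gamma_{2n-1}}:\mathfrak M\oplus\mathfrak H_0\to\mathfrak M\oplus\widetilde{\mathfrak H}_0,\qquad \mathcal L_0=\mathbf J_{\Gamma_0}\oplus\bigoplus_{n\ge1}\mathbf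 J_{\Gamma_{2n}}:\mathfrak M\oplus\widetilde{\mathfrak H}_0\to\mathfrak M\oplus\mathfrak H_0 ,$$ where the summands are grouped as $\mathfrak M\oplus\widetilde{\mathfrak H}_0=(\mathfrak M\oplus\mathfrak D_{\Gamma_0^*})\oplus\bigoplus_{n\ge1}(\mathfrak D_{\Gamma_{2n-1}}\oplus\mathfrak D_{\Gamma_{2n}^*})$ and $\mathfrak M\oplus\mathfrak H_0=(\mathfrak M\oplus\mathfrak D_{\Gamma_0})\oplus\bigoplus_{n\ge1}(\mathfrak D_{\Gamma_{2n-1}^*}\oplus\mathfrak D_{\Gamma_{2n}})$ for $\mathcal L_0$. The block operator CMV matrices are $$\mathcal U_0(\{\Gamma_n\})=\mathcal L_0\mathcal M_0\ \text{ in }\ \mathfrak M\oplus\mathfrak H_0,\qquad \widetilde{\mathcal U}_0(\{\Gamma_n\})=\mathcal M_0\mathcal L_0\ \text{ in }\ \mathfrak M\oplus\widetilde{\mathfrak H}_0 .$$ **Theorem.** Let $U$ be a unitary operator in a separable Hilbert space $\mathfrak K$ and let $\mathfrak M\subset\mathfrak K$ be a subspace that is cyclic for $U$, i.e. $\overline{\operatorname{span}}\{U^n\mathfrak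 M:n\in\mathbb Z\}=\mathfrak K$. Put $$F_{\mathfrak M}(\lambda)=P_{\mathfrak M}(U+\lambda I)(U-\lambda I)^{-1}{\upharpoonright}\,\mathfrak M,\qquad \Theta(\lambda)=\frac1\lambda\bigl(F_{\mathfrak M}^*(\bar\lambda)-I\bigr)\bigl(F_{\mathfrak M}^*(\bar\lambda)+I\bigr)^{-1},\qquad\lambda\in\mathbb D,$$ where $F_{\mathfrak M}^*(\bar\lambda)=(F_{\mathfrak M}(\bar\lambda))^*$ and $\Theta(0)$ is defined by the limit. Then the inverses exist for all $\lambda\in\mathbb D$, $\Theta$ belongs to $\mathbf S(\mathfrak M,\mathfrak M)$ and has Schur parameters $\{\Gamma_n\}_{n\ge0}$, and $U$ is unitarily equivalent both to $\mathcal U_0(\{\Gamma_n\}_{n\ge0})$ in $\mathfrak M\oplus\mathfrak H_0$ and to $\widetilde{\mathcal U}_0(\{\Gamma_n\}_{n\ge0})$ in $\mathfrak M\oplus\widetilde{\mathfrak H}_0$. -/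

import Mathlib

noncomputable section

namespace BlockCMV

open ContinuousLinearMap

/-! ### Contractions, defect operators, elementary rotations -/

section Defect

variable {H₁ H₂ : Type*}
  [NormedAddCommGroup H₁] [InnerProductSpace ℂ H₁] [CompleteSpace H₁]
  [NormedAddCommGroup H₂] [InnerProductSpace ℂ H₂] [CompleteSpace H₂]

/-- The defect operator `D_T = (I - T* T)^{1/2}` of a contraction `T : H₁ → H₂`. -/
def defectOp (T : H₁ →L[ℂ] H₂) : H₁ →L[ℂ] H₁ :=
  CFC.sqrt (1 - adjoint T ∘L T)

/-- The defect subspace `𝔇_T`, the closure of the range of `D_T`. -/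
def defectSpace (T : H₁ →L[ℂ] H₂) : Submodule ℂ H₁ :=
  (defectOp T).range.topologicalClosure

instance (T : H₁ →L[ℂ] H₂) : CompleteSpace (defectSpace T) :=
  inferInstanceAs (CompleteSpace (defectOp T).range.topologicalClosure)

lemma defectOp_mem (T : H₁ →L[ℂ] H₂) (x : H₁) : defectOp T x ∈ defectSpace T :=
  Submodule.le_topologicalClosure _ ⟨x, rfl⟩

/-- The defect operator, regarded as an operator `D_T : H₁ → 𝔇_T`. -/
def defectOpTo (T : H₁ →L[ℂ] H₂) : H₁ →L[ℂ] defectSpace T :=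
  (defectOp T).codRestrict (defectSpace T) (defectOp_mem T)

/-- The restriction of the defect operator to the defect subspace, `D_T : 𝔇_T → H₁`. -/
def defectOpFrom (T : H₁ →L[ℂ] H₂) : defectSpace T →L[ℂ] H₁ :=
  defectOp T ∘L (defectSpace T).subtypeL

lemma adjoint_defectOp (T : H₁ →L[ℂ] H₂) : adjoint (defectOp T) = defectOp T :=
  (IsSelfAdjoint.of_nonneg (CFC.sqrt_nonneg (1 - adjoint T ∘L T))).adjoint_eq

lemma one_sub_nonneg {T : H₁ →L[ℂ] H₂} (hT : ‖T‖ ≤ 1) : 0 ≤ 1 - adjoint T ∘L T := by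
  rw [nonneg_iff_isPositive, isPositive_def']
  refine ⟨?_, fun x => ?_⟩
  · exact (IsSelfAdjoint.one _).sub (isPositive_adjoint_comp_self T).isSelfAdjoint
  · have h : ‖T x‖ ≤ ‖x‖ := by simpa using T.le_of_opNorm_le hT x
    have h2 : ‖T x‖ ^ 2 ≤ ‖x‖ ^ 2 := by gcongr
    simp only [reApplyInnerSelf_apply, sub_apply, one_apply_eq_self, comp_apply, inner_sub_left,
      adjoint_inner_left, map_sub, inner_self_eq_norm_sq]
    linarith

lemma defectOp_comp_self {T : H₁ →L[ℂ] H₂} (hT : ‖T‖ ≤ 1) :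
    defectOp T ∘L defectOp T = 1 - adjoint T ∘L T :=
  CFC.sqrt_mul_sqrt_self _ (one_sub_nonneg hT)

lemma defectOp_eq_zero_iff {T : H₁ →L[ℂ] H₂} (hT : ‖T‖ ≤ 1) (x : H₁) :
    defectOp T x = 0 ↔ x = adjoint T (T x) := by
  have h := ker_adjoint_comp_self (defectOp T)
  rw [adjoint_defectOp, defectOp_comp_self hT] at h
  have h' : x ∈ (1 - adjoint T ∘L T).ker ↔ x ∈ (defectOp T).ker := by rw [h]
  simpa [sub_eq_zero] using h'.symm

lemma defectSpace_eq (T : H₁ →L[ℂ] H₂) : defectSpace T = (defectOp T).kerᗮ := by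
  rw [orthogonal_ker, adjoint_defectOp]; rfl

lemma norm_defectOp_le {T : H₁ →L[ℂ] H₂} (hT : ‖T‖ ≤ 1) : ‖defectOp T‖ ≤ 1 := by
  refine opNorm_le_bound _ zero_le_one fun x => ?_
  have h1 : ‖defectOp T x‖ ^ 2 = ‖x‖ ^ 2 - ‖T x‖ ^ 2 := by
    have h := congrArg (fun S : H₁ →L[ℂ] H₁ => RCLike.re (inner ℂ (S x) x))
      (defectOp_comp_self hT)
    nth_rw 1 [← adjoint_defectOp] at h
    simpa only [sub_apply, one_apply_eq_self, comp_apply, inner_sub_left,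
      adjoint_inner_left, map_sub, inner_self_eq_norm_sq] using h
  rw [one_mul]
  refine le_of_sq_le_sq ?_ (norm_nonneg _)
  nlinarith [sq_nonneg ‖T x‖]

/-- `T*` maps `𝔇_{T*}` into `𝔇_T`. -/
lemma adjoint_mem_defectSpace {T : H₁ →L[ℂ] H₂} (hT : ‖T‖ ≤ 1) {y : H₂}
    (hy : y ∈ defectSpace (adjoint T)) : adjoint T y ∈ defectSpace T := by
  rw [defectSpace_eq, Submodule.mem_orthogonal] at hy ⊢
  intro u hu
  have hu' : u = adjoint T (T u) := (defectOp_eq_zero_iff hT u).1 hu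
  rw [adjoint_inner_right]
  refine hy _ ?_
  have hT' : ‖adjoint T‖ ≤ 1 := by simpa using hT
  refine (defectOp_eq_zero_iff hT' (T u)).2 ?_
  rw [adjoint_adjoint, ← hu']

/-- The restriction `T* : 𝔇_{T*} → 𝔇_T`. -/
def adjointDefect (T : H₁ →L[ℂ] H₂) (hT : ‖T‖ ≤ 1) :
    defectSpace (adjoint T) →L[ℂ] defectSpace T :=
  (adjoint T ∘L (defectSpace (adjoint T)).subtypeL).codRestrict (defectSpace T)
    fun y => adjoint_mem_defectSpace hT y.2

/-- The elementary rotation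
`J_T = [T, D_{T*}; D_T, -T*] : H₁ ⊕ 𝔇_{T*} → H₂ ⊕ 𝔇_T` of a contraction `T`. When `T` is isometric
or co-isometric, one of the defect subspaces is `{0}` and `J_T` is the row `[T, I]` or the
column `[T; D_T]`. -/
def elementaryRotation (T : H₁ →L[ℂ] H₂) (hT : ‖T‖ ≤ 1) :
    WithLp 2 (H₁ × defectSpace (adjoint T)) →L[ℂ] WithLp 2 (H₂ × defectSpace T) :=
  (WithLp.prodContinuousLinearEquiv 2 ℂ H₂ (defectSpace T)).symm.toContinuousLinearMap ∘L
    ((T.coprod (defectOpFrom (adjoint T))).prod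
      ((defectOpTo T).coprod (-adjointDefect T hT))) ∘L
    (WithLp.prodContinuousLinearEquiv 2 ℂ H₁ (defectSpace (adjoint T))).toContinuousLinearMap

lemma norm_elementaryRotation_le (T : H₁ →L[ℂ] H₂) (hT : ‖T‖ ≤ 1) :
    ‖elementaryRotation T hT‖ ≤ 4 := by
  refine opNorm_le_bound _ (by norm_num) fun v => ?_
  have hT' : ‖adjoint T‖ ≤ 1 := by simpa using hT
  have b1 : ‖T v.fst‖ ≤ ‖v.fst‖ := by simpa using T.le_of_opNorm_le hT v.fst
  have b2 : ‖defectOp (adjoint T) v.snd‖ ≤ ‖v.snd‖ := by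
    simpa using (defectOp (adjoint T)).le_of_opNorm_le (norm_defectOp_le hT') v.snd
  have b3 : ‖defectOp T v.fst‖ ≤ ‖v.fst‖ := by
    simpa using (defectOp T).le_of_opNorm_le (norm_defectOp_le hT) v.fst
  have b4 : ‖adjoint T v.snd‖ ≤ ‖v.snd‖ := by
    simpa using (adjoint T).le_of_opNorm_le hT' (v.snd : H₂)
  have hv := WithLp.prod_norm_sq_eq_of_L2 v
  have hw := WithLp.prod_norm_sq_eq_of_L2 (elementaryRotation T hT v)
  have c1 : ‖(elementaryRotation T hT v).fst‖ ≤ ‖v.fst‖ + ‖v.snd‖ :=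
    (norm_add_le (T v.fst) (defectOp (adjoint T) v.snd)).trans (add_le_add b1 b2)
  have c2 : ‖(elementaryRotation T hT v).snd‖ ≤ ‖v.fst‖ + ‖v.snd‖ := by
    have h : ‖(elementaryRotation T hT v).snd‖ = ‖defectOp T v.fst + -adjoint T v.snd‖ := rfl
    rw [h]
    refine (norm_add_le _ _).trans ?_
    rw [norm_neg]
    exact add_le_add b3 b4
  refine le_of_sq_le_sq ?_ (by positivity)
  have p1 := norm_nonneg v.fst
  have p2 := norm_nonneg v.snd
  have p3 := norm_nonneg (elementaryRotation T hT v).fst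
  have p4 := norm_nonneg (elementaryRotation T hT v).snd
  nlinarith [mul_self_le_mul_self p3 c1, mul_self_le_mul_self p4 c2,
    sq_nonneg (‖v.fst‖ - ‖v.snd‖)]

end Defect

/-! ### Regrouping Hilbert sums -/

section Regroup

variable (A B : ℕ → Type*)
  [∀ n, NormedAddCommGroup (A n)] [∀ n, InnerProductSpace ℂ (A n)]
  [∀ n, NormedAddCommGroup (B n)] [∀ n, InnerProductSpace ℂ (B n)]

/-- The Hilbert sum `∑_{n ≥ 0} ⊕ (A n ⊕ B n)`. -/
abbrev PairSum : Type _ := lp (fun n => WithLp 2 (A n × B n)) 2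

variable {A B}

/-- The entries of `(a, (b₀, a₁), (b₁, a₂), …)`, regrouped as `(a, b₀), (a₁, b₁), …`. -/
def regroupFun (v : A 0 × PairSum B (fun n => A (n + 1))) : ∀ n, WithLp 2 (A n × B n)
  | 0 => WithLp.toLp 2 (v.1, (v.2 0).fst)
  | n + 1 => WithLp.toLp 2 ((v.2 n).snd, (v.2 (n + 1)).fst)

lemma pairSum_hasSum (f : PairSum A B) :
    HasSum (fun n => ‖(f n).fst‖ ^ 2 + ‖(f n).snd‖ ^ 2) (‖f‖ ^ 2) := by
  have h := lp.hasSum_norm (p := 2) (by norm_num) f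
  simpa [WithLp.prod_norm_sq_eq_of_L2] using h

lemma memlp_two_iff (f : ∀ n, WithLp 2 (A n × B n)) :
    Memℓp f 2 ↔ Summable (fun n => ‖(f n).fst‖ ^ 2 + ‖(f n).snd‖ ^ 2) := by
  rw [memℓp_gen_iff (by norm_num)]
  simp [WithLp.prod_norm_sq_eq_of_L2]

lemma regroupFun_hasSum (v : A 0 × PairSum B (fun n => A (n + 1))) :
    HasSum (fun n => ‖(regroupFun v n).fst‖ ^ 2 + ‖(regroupFun v n).snd‖ ^ 2)
      (‖v.1‖ ^ 2 + ‖v.2‖ ^ 2) := by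
  have h := pairSum_hasSum v.2
  have hb : Summable (fun n => ‖(v.2 n).fst‖ ^ 2) :=
    h.summable.of_nonneg_of_le (fun _ => by positivity)
      (fun _ => le_add_of_nonneg_right (by positivity))
  have ha : Summable (fun n => ‖(v.2 n).snd‖ ^ 2) :=
    h.summable.of_nonneg_of_le (fun _ => by positivity)
      (fun _ => le_add_of_nonneg_left (by positivity))
  have e : ‖v.2‖ ^ 2 = ∑' n, ‖(v.2 n).fst‖ ^ 2 + ∑' n, ‖(v.2 n).snd‖ ^ 2 :=
    h.unique (hb.hasSum.add ha.hasSum)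
  have hA : HasSum (fun n => ‖(regroupFun v n).fst‖ ^ 2)
      (‖v.1‖ ^ 2 + ∑' n, ‖(v.2 n).snd‖ ^ 2) := by
    have := (hasSum_nat_add_iff (f := fun n => ‖(regroupFun v n).fst‖ ^ 2) 1).1 ha.hasSum
    simpa [add_comm, regroupFun] using this
  have hB : HasSum (fun n => ‖(regroupFun v n).snd‖ ^ 2) (∑' n, ‖(v.2 n).fst‖ ^ 2) := by
    have h2 : (fun n => ‖(regroupFun v n).snd‖ ^ 2) = fun n => ‖(v.2 n).fst‖ ^ 2 := by
      funext n; cases n <;> rfl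
    rw [h2]; exact hb.hasSum
  have := hA.add hB
  rw [e]
  convert this using 1
  ring

/-- The entries of `(a₀, b₀), (a₁, b₁), …`, regrouped as `(b₀, a₁), (b₁, a₂), …`. -/
def ungroupFun (f : ∀ n, WithLp 2 (A n × B n)) (n : ℕ) : WithLp 2 (B n × A (n + 1)) :=
  WithLp.toLp 2 ((f n).snd, (f (n + 1)).fst)

lemma ungroupFun_mem (f : PairSum A B) : Memℓp (ungroupFun (f : ∀ n, WithLp 2 (A n × B n))) 2 := by
  rw [memlp_two_iff]
  have h := (pairSum_hasSum f).summable
  have hb : Summable (fun n => ‖(f n).snd‖ ^ 2) :=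
    h.of_nonneg_of_le (fun _ => by positivity)
      (fun _ => le_add_of_nonneg_left (by positivity))
  have ha : Summable (fun n => ‖(f n).fst‖ ^ 2) :=
    h.of_nonneg_of_le (fun _ => by positivity)
      (fun _ => le_add_of_nonneg_right (by positivity))
  exact hb.add ((summable_nat_add_iff 1).2 ha)

variable (A B) in
/-- The identification
`A₀ ⊕ ∑_{n ≥ 0} ⊕ (B n ⊕ A (n+1)) = ∑_{n ≥ 0} ⊕ (A n ⊕ B n)` that only moves the brackets. -/
def regroup : WithLp 2 (A 0 × PairSum B (fun n => A (n + 1))) ≃ₗᵢ[ℂ] PairSum A B where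
  toFun v := ⟨regroupFun v.ofLp, (memlp_two_iff _).2 (regroupFun_hasSum v.ofLp).summable⟩
  invFun f := WithLp.toLp 2 ((f 0).fst, ⟨ungroupFun f, ungroupFun_mem f⟩)
  map_add' v w := by
    refine lp.ext (funext fun n => ?_)
    cases n <;> rfl
  map_smul' c v := by
    refine lp.ext (funext fun n => ?_)
    cases n <;> rfl
  left_inv v := by
    refine congrArg (WithLp.toLp 2) (Prod.ext rfl (lp.ext (funext fun n => ?_)))
    cases n <;> rfl
  right_inv f := by
    refine lp.ext (funext fun n => ?_)
    cases n <;> rfl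
  norm_map' v := by
    have h1 := pairSum_hasSum (A := A) (B := B)
      ⟨regroupFun v.ofLp, (memlp_two_iff _).2 (regroupFun_hasSum v.ofLp).summable⟩
    have h2 := h1.unique (regroupFun_hasSum v.ofLp)
    have h3 := WithLp.prod_norm_sq_eq_of_L2 v
    refine (sq_eq_sq₀ (norm_nonneg _) (norm_nonneg _)).1 ?_
    rw [h3]
    exact h2

end Regroup

/-! ### Choice sequences and block operator CMV matrices -/

section Choice

variable {M N : Type*}
  [NormedAddCommGroup M] [InnerProductSpace ℂ M] [CompleteSpace M]
  [NormedAddCommGroup N] [InnerProductSpace ℂ N] [CompleteSpace N]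

variable (M N) in
/-- A choice sequence: contractions `Γ₀ ∈ L(M, N)` and
`Γ_n ∈ L(𝔇_{Γ_{n-1}}, 𝔇_{Γ_{n-1}*})` for `n ≥ 1`. The subspace `X n` of `M` is the domain of `Γ_n`
and the subspace `Y n` of `N` is its target, so that `X 0 = M`, `Y 0 = N`,
`X (n + 1) = 𝔇_{Γ_n}`, `Y (n + 1) = 𝔇_{Γ_n*}`. A sequence that stops at a unitary `Γ_m` is continued
by the zero operators on the spaces `𝔇_{Γ_m} = {0}`, `𝔇_{Γ_m*} = {0}`. -/
structure ChoiceSequence where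
  X : ℕ → Submodule ℂ M
  Y : ℕ → Submodule ℂ N
  [completeX : ∀ n, CompleteSpace (X n)]
  [completeY : ∀ n, CompleteSpace (Y n)]
  op : ∀ n, X n →L[ℂ] Y n
  contractive : ∀ n, ‖op n‖ ≤ 1
  X_zero : X 0 = ⊤
  Y_zero : Y 0 = ⊤
  X_succ : ∀ n, X (n + 1) = (defectSpace (op n)).map (X n).subtype
  Y_succ : ∀ n, Y (n + 1) = (defectSpace (adjoint (op n))).map (Y n).subtype

attribute [instance] ChoiceSequence.completeX ChoiceSequence.completeY

/-- A subspace of a subspace `P` of `E`, as a subspace of `E`. -/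
def liftSubspace {E : Type*} [NormedAddCommGroup E] [InnerProductSpace ℂ E]
    {P Q : Submodule ℂ E} (S : Submodule ℂ P) (h : Q = S.map P.subtype) : S ≃ₗᵢ[ℂ] Q where
  toLinearEquiv :=
    (Submodule.equivMapOfInjective P.subtype P.subtype_injective S).trans
      (LinearEquiv.ofEq _ _ h.symm)
  norm_map' _ := rfl

namespace ChoiceSequence

variable (Γ : ChoiceSequence M N)

/-- The identification of `𝔇_{Γ_n}`, as a subspace of `X n`, with `X (n + 1)`. -/
def idX (n : ℕ) : defectSpace (Γ.op n) ≃ₗᵢ[ℂ] Γ.X (n + 1) :=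
  liftSubspace _ (Γ.X_succ n)

/-- The identification of `𝔇_{Γ_n*}`, as a subspace of `Y n`, with `Y (n + 1)`. -/
def idY (n : ℕ) : defectSpace (adjoint (Γ.op n)) ≃ₗᵢ[ℂ] Γ.Y (n + 1) :=
  liftSubspace _ (Γ.Y_succ n)

/-- The elementary rotation
`J_{Γ_n} : 𝔇_{Γ_{n-1}} ⊕ 𝔇_{Γ_n*} → 𝔇_{Γ_{n-1}*} ⊕ 𝔇_{Γ_n}`, and
`J_{Γ₀} : M ⊕ 𝔇_{Γ₀*} → N ⊕ 𝔇_{Γ₀}`. -/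
def J (n : ℕ) : WithLp 2 (Γ.X n × Γ.Y (n + 1)) →L[ℂ] WithLp 2 (Γ.Y n × Γ.X (n + 1)) :=
  (LinearIsometryEquiv.withLpProdCongr 2
      (LinearIsometryEquiv.refl ℂ (Γ.Y n)) (Γ.idX n)).toContinuousLinearEquiv.toContinuousLinearMap ∘L
    elementaryRotation (Γ.op n) (Γ.contractive n) ∘L
    (LinearIsometryEquiv.withLpProdCongr 2
      (LinearIsometryEquiv.refl ℂ (Γ.X n))
      (Γ.idY n).symm).toContinuousLinearEquiv.toContinuousLinearMap

lemma norm_J_le (n : ℕ) : ‖Γ.J n‖ ≤ 4 := by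
  refine opNorm_le_bound _ (by norm_num) fun v => ?_
  have h := (elementaryRotation (Γ.op n) (Γ.contractive n)).le_of_opNorm_le
    (norm_elementaryRotation_le _ _)
    ((LinearIsometryEquiv.withLpProdCongr 2 (LinearIsometryEquiv.refl ℂ (Γ.X n))
      (Γ.idY n).symm) v)
  rw [LinearIsometryEquiv.norm_map] at h
  refine le_trans (le_of_eq ?_) h
  exact (LinearIsometryEquiv.withLpProdCongr 2
      (LinearIsometryEquiv.refl ℂ (Γ.Y n)) (Γ.idX n)).norm_map _

/-- `ℌ₀ = ∑_{n ≥ 0} ⊕ (𝔇_{Γ_{2n}} ⊕ 𝔇_{Γ_{2n+1}*})`. -/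
abbrev H : Type _ := PairSum (fun n => Γ.X (2 * n + 1)) (fun n => Γ.Y (2 * n + 2))

/-- `ℌ̃₀ = ∑_{n ≥ 0} ⊕ (𝔇_{Γ_{2n}*} ⊕ 𝔇_{Γ_{2n+1}})`. -/
abbrev Htilde : Type _ := PairSum (fun n => Γ.Y (2 * n + 1)) (fun n => Γ.X (2 * n + 2))

/-- The block diagonal operator `V₀ = ∑_{n ≥ 1} ⊕ J_{Γ_{2n-1}} : ℌ₀ → ℌ̃₀`. -/
def V : Γ.H →L[ℂ] Γ.Htilde :=
  lp.mapCLM 2 (fun n => Γ.J (2 * n + 1)) (K := 4) (by norm_num) (fun n => Γ.norm_J_le (2 * n + 1))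

/-- The block diagonal operator `I_E ⊕ Γ.V : E ⊕ ℌ₀ → E ⊕ ℌ̃₀`. -/
def idOplusV (E : Type*) [NormedAddCommGroup E] [InnerProductSpace ℂ E] :
    WithLp 2 (E × Γ.H) →L[ℂ] WithLp 2 (E × Γ.Htilde) :=
  (WithLp.prodContinuousLinearEquiv 2 ℂ E Γ.Htilde).symm.toContinuousLinearMap ∘L
    ((ContinuousLinearMap.id ℂ E).prodMap Γ.V) ∘L
    (WithLp.prodContinuousLinearEquiv 2 ℂ E Γ.H).toContinuousLinearMap

/-- `M₀ = I_M ⊕ ∑_{n ≥ 1} ⊕ J_{Γ_{2n-1}} : M ⊕ ℌ₀ → M ⊕ ℌ̃₀`. -/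
def opM : WithLp 2 (M × Γ.H) →L[ℂ] WithLp 2 (M × Γ.Htilde) := Γ.idOplusV M

/-- `M̃₀ = I_N ⊕ ∑_{n ≥ 1} ⊕ J_{Γ_{2n-1}} : N ⊕ ℌ₀ → N ⊕ ℌ̃₀`. -/
def opMtilde : WithLp 2 (N × Γ.H) →L[ℂ] WithLp 2 (N × Γ.Htilde) := Γ.idOplusV N

/-- `M ⊕ ℌ̃₀ = (M ⊕ 𝔇_{Γ₀*}) ⊕ ∑_{n ≥ 1} ⊕ (𝔇_{Γ_{2n-1}} ⊕ 𝔇_{Γ_{2n}*})`. -/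
def groupM : WithLp 2 (M × Γ.Htilde) ≃ₗᵢ[ℂ]
    PairSum (fun n => Γ.X (2 * n)) (fun n => Γ.Y (2 * n + 1)) :=
  (LinearIsometryEquiv.withLpProdCongr 2 (LinearIsometryEquiv.ofTop M (Γ.X 0) Γ.X_zero).symm
    (LinearIsometryEquiv.refl ℂ Γ.Htilde)).trans
    (regroup (fun n => Γ.X (2 * n)) (fun n => Γ.Y (2 * n + 1)))

/-- `N ⊕ ℌ₀ = (N ⊕ 𝔇_{Γ₀}) ⊕ ∑_{n ≥ 1} ⊕ (𝔇_{Γ_{2n-1}*} ⊕ 𝔇_{Γ_{2n}})`. -/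
def groupN : WithLp 2 (N × Γ.H) ≃ₗᵢ[ℂ]
    PairSum (fun n => Γ.Y (2 * n)) (fun n => Γ.X (2 * n + 1)) :=
  (LinearIsometryEquiv.withLpProdCongr 2 (LinearIsometryEquiv.ofTop N (Γ.Y 0) Γ.Y_zero).symm
    (LinearIsometryEquiv.refl ℂ Γ.H)).trans
    (regroup (fun n => Γ.Y (2 * n)) (fun n => Γ.X (2 * n + 1)))

/-- `L₀ = J_{Γ₀} ⊕ ∑_{n ≥ 1} ⊕ J_{Γ_{2n}} : M ⊕ ℌ̃₀ → N ⊕ ℌ₀`. -/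
def opL : WithLp 2 (M × Γ.Htilde) →L[ℂ] WithLp 2 (N × Γ.H) :=
  Γ.groupN.symm.toContinuousLinearEquiv.toContinuousLinearMap ∘L
    lp.mapCLM 2 (fun n => Γ.J (2 * n)) (K := 4) (by norm_num) (fun n => Γ.norm_J_le (2 * n)) ∘L
    Γ.groupM.toContinuousLinearEquiv.toContinuousLinearMap

/-- The block operator CMV matrix `U₀({Γ_n}) = L₀ M₀ : M ⊕ ℌ₀ → N ⊕ ℌ₀`. -/
def cmv : WithLp 2 (M × Γ.H) →L[ℂ] WithLp 2 (N × Γ.H) := Γ.opL ∘L Γ.opM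

/-- The block operator CMV matrix `Ũ₀({Γ_n}) = M̃₀ L₀ : M ⊕ ℌ̃₀ → N ⊕ ℌ̃₀`. -/
def cmvTilde : WithLp 2 (M × Γ.Htilde) →L[ℂ] WithLp 2 (N × Γ.Htilde) := Γ.opMtilde ∘L Γ.opL

end ChoiceSequence

/-! ### The Schur class and the operator Schur algorithm -/

/-- The Schur class: holomorphic contractive operator functions on the open unit disk. (The values
of `Θ` outside the open unit disk are irrelevant.) -/
def IsSchurClass {E F : Type*} [NormedAddCommGroup E] [InnerProductSpace ℂ E]
    [NormedAddCommGroup F] [InnerProductSpace ℂ F] (Θ : ℂ → E →L[ℂ] F) : Prop :=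
  DifferentiableOn ℂ Θ (Metric.ball 0 1) ∧ ∀ z ∈ Metric.ball (0 : ℂ) 1, ‖Θ z‖ ≤ 1

/-- `Z` is the Möbius parameter of the Schur class function `Θ` with `Θ(0) = T`: the Schur class
function with values in `L(𝔇_T, 𝔇_{T*})` such that
`Θ(z) = T + D_{T*} Z(z) (I + T* Z(z))⁻¹ D_T` in the disk and `Z(0) = 0`. (As `‖Z(z)‖ ≤ |z| < 1`, the
inverse exists.) -/
def IsMobiusParameter {E F : Type*}
    [NormedAddCommGroup E] [InnerProductSpace ℂ E] [CompleteSpace E]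
    [NormedAddCommGroup F] [InnerProductSpace ℂ F] [CompleteSpace F]
    (T : E →L[ℂ] F) (hT : ‖T‖ ≤ 1) (Θ : ℂ → E →L[ℂ] F)
    (Z : ℂ → defectSpace T →L[ℂ] defectSpace (adjoint T)) : Prop :=
  Θ 0 = T ∧ IsSchurClass Z ∧ Z 0 = 0 ∧ ∀ z ∈ Metric.ball (0 : ℂ) 1,
    Θ z = T + defectOpFrom (adjoint T) ∘L Z z ∘L
      Ring.inverse (1 + adjointDefect T hT ∘L Z z) ∘L defectOpTo T

/-- `Γ` is the sequence of Schur parameters of `Θ`: there are Schur class functions (the Schur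
iterates) `Θ₀ = Θ`, `Θ_{n+1}(z) = Z_n(z) / z` with `Z_n` the Möbius parameter of `Θ_n`, such that
`Γ_n = Θ_n(0)`. -/
def ChoiceSequence.IsSchurParameters (Γ : ChoiceSequence M N) (Θ : ℂ → M →L[ℂ] N) : Prop :=
  ∃ it : ∀ n, ℂ → Γ.X n →L[ℂ] Γ.Y n,
    (∀ z ∈ Metric.ball (0 : ℂ) 1, ∀ x : Γ.X 0, (it 0 z x : N) = Θ z x) ∧
    (∀ n, IsSchurClass (it n)) ∧
    ∀ n, IsMobiusParameter (Γ.op n) (Γ.contractive n) (it n) fun z =>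
      z • ((Γ.idY n).symm.toContinuousLinearEquiv.toContinuousLinearMap ∘L it (n + 1) z ∘L
        (Γ.idX n).toContinuousLinearEquiv.toContinuousLinearMap)

end Choice

/-! ### Unitary operators with cyclic subspaces -/

section Cyclic

variable {K : Type*} [NormedAddCommGroup K] [InnerProductSpace ℂ K] [CompleteSpace K]

/-- The subspace `𝔐` is cyclic for `U`: the closed span of all `Uⁿ 𝔐`, `n ∈ ℤ`, is the space. -/
def IsCyclicSubspace (U : unitary (K →L[ℂ] K)) (𝔐 : Submodule ℂ K) : Prop :=
  (⨆ n : ℤ, 𝔐.map (((U ^ n : unitary (K →L[ℂ] K)) : K →L[ℂ] K) : K →ₗ[ℂ] K)).topologicalClosure = ⊤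

/-- `F_𝔐(z) = P_𝔐 (U + z I)(U - z I)⁻¹ ↾ 𝔐`. -/
def caratheodory (U : unitary (K →L[ℂ] K)) (𝔐 : Submodule ℂ K) [CompleteSpace 𝔐] (z : ℂ) :
    𝔐 →L[ℂ] 𝔐 :=
  𝔐.orthogonalProjectionOnto ∘L
    (((U : K →L[ℂ] K) + z • 1) * Ring.inverse ((U : K →L[ℂ] K) - z • 1)) ∘L 𝔐.subtypeL

/-- `F_𝔐*(z̄)`, the adjoint of `F_𝔐` at the conjugate point. -/
def caratheodoryAdj (U : unitary (K →L[ℂ] K)) (𝔐 : Submodule ℂ K) [CompleteSpace 𝔐] (z : ℂ) :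
    𝔐 →L[ℂ] 𝔐 :=
  adjoint (caratheodory U 𝔐 (starRingEnd ℂ z))

/-- `Θ(z) = z⁻¹ (F_𝔐*(z̄) - I)(F_𝔐*(z̄) + I)⁻¹`, with the removable singularity at `z = 0` filled in
by the limit. -/
def schurFunction (U : unitary (K →L[ℂ] K)) (𝔐 : Submodule ℂ K) [CompleteSpace 𝔐] :
    ℂ → 𝔐 →L[ℂ] 𝔐 :=
  let Θ : ℂ → 𝔐 →L[ℂ] 𝔐 := fun z =>
    z⁻¹ • ((caratheodoryAdj U 𝔐 z - 1) * Ring.inverse (caratheodoryAdj U 𝔐 z + 1))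
  Function.update Θ 0 (Filter.limUnder (nhdsWithin 0 {0}ᶜ) Θ)

/-- Unitary equivalence of operators: `W A = B W` for some unitary operator `W`. -/
def UnitarilyEquivalent {E F : Type*} [NormedAddCommGroup E] [InnerProductSpace ℂ E]
    [NormedAddCommGroup F] [InnerProductSpace ℂ F] (A : E →L[ℂ] E) (B : F →L[ℂ] F) : Prop :=
  ∃ W : E ≃ₗᵢ[ℂ] F, ∀ x, W (A x) = B (W x)

end Cyclic

end BlockCMV

end

noncomputable section

namespace BlockCMV

open ContinuousLinearMap

set_option linter.unusedSectionVars false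

/-! ### Intertwining of defect operators -/

section Intertwine

variable {E F G : Type*}
  [NormedAddCommGroup E] [InnerProductSpace ℂ E] [CompleteSpace E]
  [NormedAddCommGroup F] [InnerProductSpace ℂ F] [CompleteSpace F]
  [NormedAddCommGroup G] [InnerProductSpace ℂ G] [CompleteSpace G]

/-! A unitary operator carries its own Schur algorithm. Let `p`, `q` be isometries of E, F into a
closed subspace L such that the unitary u maps L ⊖ ran q onto L ⊖ ran p (`IsStage`). For |z| < 1 and
given x, the equation p x + z u v = q y + v with v ∈ L ⊖ ran q is solvable and determines y = Θ(z)
x. Orthogonality gives ‖x‖² + |z|²‖v‖² = ‖y‖² + ‖v‖², so Θ is a Schur function, and Θ(0) = q* p. For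
L = K, q the inclusion of 𝔐 and p = U↾𝔐, a Cayley transform identifies Θ with the Schur function of
the theorem (`schurFunction_eq`).

One step of the Schur algorithm is then geometric. With T = Θ(0), the component of p x orthogonal to
ran q has norm ‖D_T x‖, and that of q y orthogonal to ran p has norm ‖D_{T*} y‖. They define
isometries on the defect spaces; after pulling the second one back by u, these are the channels p',
q' of a stage in L ⊖ ran q (`IsStage.exists_next`). Old and new channels are tied by J_T
(`IsRotated`), and this relation shows that the new transfer function is the Schur iterate
(`IsStage.isMobiusParameter`). Iteration gives existence of Schur parameters. Conversely, as
iterates are unique (`iterate_unique`), the stages can be built along any given sequence of Schur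
parameters (`exists_isChain`).

Along such a chain the maps (y, x) ↦ uⁿ(q_{2n} y + p_{2n+1} x) are isometries with mutually
orthogonal ranges and add up to an isometry W of 𝔐 ⊕ ℌ₀ into K. The rotations of even index account
for L₀ and those of odd index for M₀, whence W L₀ M₀ = U W. The range of W is closed, invariant
under U and U⁻¹, and contains 𝔐, so cyclicity makes W unitary. Finally M₀ intertwines L₀ M₀ with M₀
L₀. -/

/-- The block operator `[A, B; C, D]` on the Hilbert sum `E ⊕ F`. -/
def blockOp (A : E →L[ℂ] E) (B : F →L[ℂ] E) (C : E →L[ℂ] F) (D : F →L[ℂ] F) :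
    WithLp 2 (E × F) →L[ℂ] WithLp 2 (E × F) :=
  (WithLp.prodContinuousLinearEquiv 2 ℂ E F).symm.toContinuousLinearMap ∘L
    ((A.coprod B).prod (C.coprod D)) ∘L
    (WithLp.prodContinuousLinearEquiv 2 ℂ E F).toContinuousLinearMap

lemma blockOp_apply (A : E →L[ℂ] E) (B : F →L[ℂ] E) (C : E →L[ℂ] F) (D : F →L[ℂ] F)
    (v : WithLp 2 (E × F)) :
    blockOp A B C D v = WithLp.toLp 2 (A v.fst + B v.snd, C v.fst + D v.snd) := rfl

lemma blockOp_diag_nonneg {A : E →L[ℂ] E} {D : F →L[ℂ] F} (hA : 0 ≤ A) (hD : 0 ≤ D) :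
    0 ≤ blockOp A 0 0 D := by
  rw [nonneg_iff_isPositive] at hA hD ⊢
  refine ⟨fun v w => ?_, fun v => ?_⟩
  · have h1 := hA.isSymmetric v.fst w.fst
    have h2 := hD.isSymmetric v.snd w.snd
    simp only [ContinuousLinearMap.coe_coe] at h1 h2
    simp [blockOp_apply, WithLp.prod_inner_apply, h1, h2]
  · have h1 := hA.re_inner_nonneg_left v.fst
    have h2 := hD.re_inner_nonneg_left v.snd
    simp only [reApplyInnerSelf_apply, blockOp_apply, WithLp.prod_inner_apply]
    simpa using add_nonneg h1 h2

lemma commute_of_sq_commute {P R N : E →L[ℂ] E} (hR : 0 ≤ R) (h : R * R = P)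
    (hN : Commute P N) : Commute R N := by
  rw [← CFC.sqrt_unique h hR]
  exact hN.cfcₙ_nnreal _

/-- The hypothesis says that `A ⊕ B` commutes with the block operator whose only entry is the corner
`S`. The square root `√A ⊕ √B` lies in the functional calculus of `A ⊕ B`, hence commutes with it
too. -/
lemma sqrt_comp_eq_comp_sqrt {A : E →L[ℂ] E} {B : F →L[ℂ] F} {S : F →L[ℂ] E}
    (hA : 0 ≤ A) (hB : 0 ≤ B) (h : A ∘L S = S ∘L B) :
    CFC.sqrt A ∘L S = S ∘L CFC.sqrt B := by
  have hcomm : Commute (blockOp A 0 0 B) (blockOp 0 S 0 0) := by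
    refine ContinuousLinearMap.ext fun v => ?_
    have := DFunLike.congr_fun h v.snd
    simp only [ContinuousLinearMap.comp_apply] at this
    simp [blockOp_apply, this]
  have hsq : blockOp (CFC.sqrt A) 0 0 (CFC.sqrt B) * blockOp (CFC.sqrt A) 0 0 (CFC.sqrt B) =
      blockOp A 0 0 B := by
    refine ContinuousLinearMap.ext fun v => ?_
    have h1 := DFunLike.congr_fun (CFC.sqrt_mul_sqrt_self A hA) v.fst
    have h2 := DFunLike.congr_fun (CFC.sqrt_mul_sqrt_self B hB) v.snd
    simp only [mul_apply_eq_comp] at h1 h2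
    simp [blockOp_apply, h1, h2]
  have hc := commute_of_sq_commute
    (blockOp_diag_nonneg (CFC.sqrt_nonneg A) (CFC.sqrt_nonneg B)) hsq hcomm
  ext y
  have := congrArg WithLp.fst (DFunLike.congr_fun hc.eq (WithLp.toLp 2 (0, y)))
  simpa [blockOp_apply] using this

lemma comp_defectOp {T : E →L[ℂ] F} (hT : ‖T‖ ≤ 1) :
    T ∘L defectOp T = defectOp (adjoint T) ∘L T := by
  refine (sqrt_comp_eq_comp_sqrt (one_sub_nonneg (by simpa using hT)) (one_sub_nonneg hT) ?_).symm
  ext x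
  simp

lemma map_defectOp {T : E →L[ℂ] F} (hT : ‖T‖ ≤ 1) (x : E) :
    T (defectOp T x) = defectOp (adjoint T) (T x) :=
  DFunLike.congr_fun (comp_defectOp hT) x

lemma adjoint_map_defectOp {T : E →L[ℂ] F} (hT : ‖T‖ ≤ 1) (y : F) :
    adjoint T (defectOp (adjoint T) y) = defectOp T (adjoint T y) := by
  simpa using map_defectOp (T := adjoint T) (by simpa using hT) y

lemma defectOp_defectOp {T : E →L[ℂ] F} (hT : ‖T‖ ≤ 1) (x : E) :
    defectOp T (defectOp T x) = x - adjoint T (T x) :=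
  DFunLike.congr_fun (defectOp_comp_self hT) x

lemma defectOp_adjoint_defectOp {T : E →L[ℂ] F} (hT : ‖T‖ ≤ 1) (y : F) :
    defectOp (adjoint T) (defectOp (adjoint T) y) = y - T (adjoint T y) := by
  simpa using defectOp_defectOp (T := adjoint T) (by simpa using hT) y

lemma inner_defectOp (T : E →L[ℂ] F) (x y : E) :
    inner ℂ (defectOp T x) y = inner ℂ x (defectOp T y) := by
  nth_rw 1 [← adjoint_defectOp, adjoint_inner_left]

lemma norm_defectOp_sq {T : E →L[ℂ] F} (hT : ‖T‖ ≤ 1) (x : E) :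
    ‖defectOp T x‖ ^ 2 = ‖x‖ ^ 2 - ‖T x‖ ^ 2 := by
  have h : inner ℂ (defectOp T x) (defectOp T x) = inner ℂ x x - inner ℂ (T x) (T x) := by
    rw [inner_defectOp, defectOp_defectOp hT, inner_sub_right, adjoint_inner_right]
  simp only [inner_self_eq_norm_sq_to_K] at h
  exact_mod_cast h

lemma map_mem_defectSpace {T : E →L[ℂ] F} (hT : ‖T‖ ≤ 1) {x : E} (hx : x ∈ defectSpace T) :
    T x ∈ defectSpace (adjoint T) := by
  have h := adjoint_mem_defectSpace (T := adjoint T) (y := x) (by simpa using hT)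
  rw [adjoint_adjoint] at h
  exact h hx

lemma denseRange_defectOpTo (T : E →L[ℂ] F) : DenseRange (defectOpTo T) := by
  intro x
  have hx : (x : E) ∈ closure (Set.range (defectOp T)) := by
    exact (Submodule.topologicalClosure_coe (defectOp T).range).subset x.2
  rw [closure_subtype, ← Set.range_comp]
  exact hx

/-- The defect space is the orthogonal complement of the kernel of the defect operator. -/
lemma defectOpFrom_injective {T : E →L[ℂ] F} : Function.Injective (defectOpFrom T) := by
  rw [← ContinuousLinearMap.coe_coe, ← LinearMap.ker_eq_bot, LinearMap.ker_eq_bot']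
  intro x hx
  have h1 : ∀ z ∈ defectSpace T, ∀ u, defectOp T u = 0 → inner ℂ u z = 0 := fun z hz => by
    rw [defectSpace_eq, Submodule.mem_orthogonal] at hz
    exact hz
  have h2 := h1 x x.2 x hx
  exact Subtype.ext (inner_self_eq_zero.1 h2)

/-! ### The elementary rotation is unitary -/

lemma norm_elementaryRotation (T : E →L[ℂ] F) (hT : ‖T‖ ≤ 1)
    (v : WithLp 2 (E × defectSpace (adjoint T))) : ‖elementaryRotation T hT v‖ = ‖v‖ := by
  refine (sq_eq_sq₀ (norm_nonneg _) (norm_nonneg _)).1 ?_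
  rw [WithLp.prod_norm_sq_eq_of_L2, WithLp.prod_norm_sq_eq_of_L2]
  change ‖T v.fst + defectOp (adjoint T) v.snd‖ ^ 2 + ‖defectOp T v.fst + -adjoint T v.snd‖ ^ 2 =
    ‖v.fst‖ ^ 2 + ‖(v.snd : F)‖ ^ 2
  -- The cross terms cancel: ⟨Tx, D_{T*}y⟩ = ⟨D_{T*}Tx, y⟩ = ⟨T D_T x, y⟩ = ⟨D_T x, T*y⟩.
  rw [← sub_eq_add_neg, @norm_add_sq ℂ, @norm_sub_sq ℂ, norm_defectOp_sq hT,
    norm_defectOp_sq (T := adjoint T) (by simpa using hT), ← inner_defectOp, ← map_defectOp hT,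
    adjoint_inner_right]
  ring

lemma elementaryRotation_surjective (T : E →L[ℂ] F) (hT : ‖T‖ ≤ 1) :
    Function.Surjective (elementaryRotation T hT) := by
  intro w
  -- The preimage is J_T* w, where J_T* has rows (T*, D_T) and (D_{T*}, -T).
  refine ⟨WithLp.toLp 2 (adjoint T w.fst + defectOp T w.snd,
    ⟨defectOp (adjoint T) w.fst - T w.snd,
      Submodule.sub_mem _ (defectOp_mem _ _) (map_mem_defectSpace hT w.snd.2)⟩), ?_⟩
  refine congrArg (WithLp.toLp 2) (Prod.ext ?_ (Subtype.ext ?_))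
  · change T (adjoint T w.fst + defectOp T w.snd) +
      defectOp (adjoint T) (defectOp (adjoint T) w.fst - T w.snd) = w.fst
    rw [map_add, map_sub, map_defectOp hT, defectOp_adjoint_defectOp hT]
    abel
  · change defectOp T (adjoint T w.fst + defectOp T w.snd) +
      -adjoint T (defectOp (adjoint T) w.fst - T w.snd) = w.snd
    rw [map_add, map_sub, adjoint_map_defectOp hT, defectOp_defectOp hT]
    abel

/-- An operator with `‖B x‖ = ‖A x‖` for all `x` factors through `A` by an isometry. -/
lemma exists_isometry_comp_eq {A : E →L[ℂ] F} {B : E →L[ℂ] G} (hA : DenseRange A)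
    (h : ∀ x, ‖B x‖ = ‖A x‖) : ∃ R : F →ₗᵢ[ℂ] G, ∀ x, R (A x) = B x := by
  let f : F →L[ℂ] G := LinearMap.extendOfNorm (B : E →ₗ[ℂ] G) (A : E →ₗ[ℂ] F)
  have hf : ∀ x, f (A x) = B x := fun x =>
    LinearMap.extendOfNorm_eq (f := (B : E →ₗ[ℂ] G)) (e := (A : E →ₗ[ℂ] F)) hA
      ⟨1, fun x => by simp [h x]⟩ x
  refine ⟨⟨f, fun x => ?_⟩, hf⟩
  refine hA.induction_on (p := fun x => ‖f x‖ = ‖x‖) x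
    (isClosed_eq f.continuous.norm continuous_norm) ?_
  intro x
  rw [hf, h]

end Intertwine

/-! ### The geometric Schur algorithm -/

section Stage

variable {K E F E' F' : Type*}
  [NormedAddCommGroup K] [InnerProductSpace ℂ K] [CompleteSpace K]
  [NormedAddCommGroup E] [InnerProductSpace ℂ E] [CompleteSpace E]
  [NormedAddCommGroup F] [InnerProductSpace ℂ F] [CompleteSpace F]
  [NormedAddCommGroup E'] [InnerProductSpace ℂ E'] [CompleteSpace E']
  [NormedAddCommGroup F'] [InnerProductSpace ℂ F'] [CompleteSpace F']

/-- The orthogonal complement in `L` of the range of `q`. -/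
def residual (L : Submodule ℂ K) (q : F →ₗᵢ[ℂ] K) : Submodule ℂ K :=
  L ⊓ q.toLinearMap.rangeᗮ

lemma mem_residual {L : Submodule ℂ K} {q : F →ₗᵢ[ℂ] K} {v : K} :
    v ∈ residual L q ↔ v ∈ L ∧ ∀ y, inner ℂ (q y) v = 0 := by
  simp [residual, Submodule.mem_orthogonal]

/-- The isometries `p` and `q` into `L` are the channels of a unitary colligation whose main
operator is a part of `u`: `u` maps the orthogonal complement of the range of `q` in `L` onto that
of the range of `p`. -/
structure IsStage (u : K ≃ₗᵢ[ℂ] K) (L : Submodule ℂ K) (p : E →ₗᵢ[ℂ] K) (q : F →ₗᵢ[ℂ] K) :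
    Prop where
  closed : IsClosed (L : Set K)
  p_mem : ∀ x, p x ∈ L
  q_mem : ∀ y, q y ∈ L
  shift : ∀ v, v ∈ residual L q ↔ u v ∈ residual L p

lemma isClosed_residual {L : Submodule ℂ K} (hL : IsClosed (L : Set K)) (q : F →ₗᵢ[ℂ] K) :
    IsClosed (residual L q : Set K) :=
  hL.inter (Submodule.isClosed_orthogonal _)

/-- The hypothesis is q* p = T, so p x - q T x is the component of p x orthogonal to ran q, and its
squared norm is ‖x‖² - ‖Tx‖² = ‖D_T x‖². -/
lemma exists_defect_isometry {T : E →L[ℂ] F} (hT : ‖T‖ ≤ 1) {p : E →ₗᵢ[ℂ] K} {q : F →ₗᵢ[ℂ] K}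
    (h : ∀ x y, inner ℂ (q y) (p x) = inner ℂ y (T x)) :
    ∃ R : defectSpace T →ₗᵢ[ℂ] K, ∀ x, R (defectOpTo T x) = p x - q (T x) := by
  refine exists_isometry_comp_eq (B := p.toContinuousLinearMap - q.toContinuousLinearMap ∘L T)
    (denseRange_defectOpTo T) fun x => ?_
  change ‖p x - q (T x)‖ = ‖defectOp T x‖
  refine (sq_eq_sq₀ (norm_nonneg _) (norm_nonneg _)).1 ?_
  rw [norm_defectOp_sq hT, @norm_sub_sq ℂ, ← inner_conj_symm, h, inner_self_eq_norm_sq_to_K,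
    p.norm_map, q.norm_map]
  have : RCLike.re ((starRingEnd ℂ) ((‖T x‖ : ℂ) ^ 2)) = ‖T x‖ ^ 2 := by
    rw [← Complex.ofReal_pow, Complex.conj_ofReal]; rfl
  linear_combination -2 * this

lemma inner_eq_zero_iff_of_denseRange {A : E →L[ℂ] F} (hA : DenseRange A) (R : F →ₗᵢ[ℂ] K)
    (w : K) : (∀ z, inner ℂ (R z) w = 0) ↔ ∀ x, inner ℂ (R (A x)) w = 0 := by
  refine ⟨fun h x => h _, fun h z => ?_⟩
  exact hA.induction_on (p := fun z => inner ℂ (R z) w = 0) z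
    (isClosed_eq (R.continuous.inner continuous_const) continuous_const) h

lemma mem_of_denseRange {A : E →L[ℂ] F} (hA : DenseRange A) (R : F →ₗᵢ[ℂ] K) {L : Submodule ℂ K}
    (hL : IsClosed (L : Set K)) (h : ∀ x, R (A x) ∈ L) (z : F) : R z ∈ L :=
  hA.induction_on (p := fun z => R z ∈ L) z (hL.preimage R.continuous) h

/-- `p'` and `q'` arise from `p` and `q` by the elementary rotation of `T`. -/
def IsRotated (u : K ≃ₗᵢ[ℂ] K) (p : E →ₗᵢ[ℂ] K) (q : F →ₗᵢ[ℂ] K) (T : E →L[ℂ] F) (hT : ‖T‖ ≤ 1)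
    (α : defectSpace T ≃ₗᵢ[ℂ] E') (β : defectSpace (adjoint T) ≃ₗᵢ[ℂ] F')
    (p' : E' →ₗᵢ[ℂ] K) (q' : F' →ₗᵢ[ℂ] K) : Prop :=
  ∀ x (y : defectSpace (adjoint T)), p x + u (q' (β y)) =
    q (T x + defectOpFrom (adjoint T) y) + p' (α (defectOpTo T x - adjointDefect T hT y))

/-- The new channels are p' D_T x = p x - q T x and u q' D_{T*} y = q y - p T* y, up to the
identifications `α`, `β`. The second takes values in L ⊖ ran p, which is why u⁻¹ brings it into L ⊖
ran q. -/
theorem IsStage.exists_next {u : K ≃ₗᵢ[ℂ] K} {L : Submodule ℂ K} {p : E →ₗᵢ[ℂ] K}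
    {q : F →ₗᵢ[ℂ] K} (hs : IsStage u L p q) {T : E →L[ℂ] F} (hT : ‖T‖ ≤ 1)
    (h : ∀ x y, inner ℂ (q y) (p x) = inner ℂ y (T x))
    (α : defectSpace T ≃ₗᵢ[ℂ] E') (β : defectSpace (adjoint T) ≃ₗᵢ[ℂ] F') :
    ∃ (p' : E' →ₗᵢ[ℂ] K) (q' : F' →ₗᵢ[ℂ] K), IsStage u (residual L q) p' q' ∧
      IsRotated u p q T hT α β p' q' := by
  have hT' : ‖adjoint T‖ ≤ 1 := by simpa using hT
  have h' : ∀ y x, inner ℂ (p x) (q y) = inner ℂ x (adjoint T y) := fun y x => by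
    rw [← inner_conj_symm, h, inner_conj_symm, adjoint_inner_right]
  obtain ⟨R, hR⟩ := exists_defect_isometry hT h
  obtain ⟨S, hS⟩ := exists_defect_isometry hT' h'
  have dR := denseRange_defectOpTo T
  have dS := denseRange_defectOpTo (adjoint T)
  have hRmem : ∀ z, R z ∈ residual L q := mem_of_denseRange dR R (isClosed_residual hs.closed q)
    fun x => by
      rw [hR, mem_residual]
      refine ⟨L.sub_mem (hs.p_mem _) (hs.q_mem _), fun y => ?_⟩
      rw [inner_sub_right, h, q.inner_map_map, sub_self]
  have hSmem : ∀ z, S z ∈ residual L p := mem_of_denseRange dS S (isClosed_residual hs.closed p)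
    fun y => by
      rw [hS, mem_residual]
      refine ⟨L.sub_mem (hs.q_mem _) (hs.p_mem _), fun x => ?_⟩
      rw [inner_sub_right, h', p.inner_map_map, sub_self]
  refine ⟨R.comp α.symm.toLinearIsometry,
    (u.symm.toLinearIsometry.comp S).comp β.symm.toLinearIsometry,
    ⟨isClosed_residual hs.closed q, fun x => hRmem _, fun y => ?_, fun v => ?_⟩, fun x y => ?_⟩
  · rw [hs.shift]
    simpa using hSmem _
  · have e1 : (∀ y, inner ℂ ((u.symm.toLinearIsometry.comp S).comp β.symm.toLinearIsometry y) v = 0)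
        ↔ ∀ y, inner ℂ (q y) (u v) = inner ℂ (p (adjoint T y)) (u v) := by
      refine (β.symm.surjective.forall (p := fun z => inner ℂ (u.symm (S z)) v = 0)).symm.trans ?_
      have : ∀ z, inner ℂ (u.symm (S z)) v = inner ℂ (S z) (u v) := fun z => by
        rw [← u.inner_map_map, u.apply_symm_apply]
      simp only [this]
      rw [inner_eq_zero_iff_of_denseRange dS]
      simp only [hS, inner_sub_left, sub_eq_zero]
    have e2 : (∀ x, inner ℂ (R.comp α.symm.toLinearIsometry x) (u v) = 0)
        ↔ ∀ x, inner ℂ (p x) (u v) = inner ℂ (q (T x)) (u v) := by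
      refine (α.symm.surjective.forall (p := fun z => inner ℂ (R z) (u v) = 0)).symm.trans ?_
      rw [inner_eq_zero_iff_of_denseRange dR]
      simp only [hR, inner_sub_left, sub_eq_zero]
    -- Both sides reduce to one symmetric condition: `u v` lies in `L` and is orthogonal to both ran
    -- p and ran q.
    rw [mem_residual (L := residual L q), mem_residual (L := residual L q), e1, e2, hs.shift,
      mem_residual, mem_residual]
    constructor
    · rintro ⟨⟨h1, h2⟩, h3⟩
      simp only [h2] at h3 ⊢
      exact ⟨⟨h1, h3⟩, fun x => (h3 _).symm⟩
    · rintro ⟨⟨h1, h2⟩, h3⟩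
      simp only [h2] at h3 ⊢
      exact ⟨⟨h1, h3⟩, fun x => (h3 _).symm⟩
  -- By density it suffices to test vectors D_{T*} y, where the identity follows from D_{T*}² = I -
  -- T T* and T* D_{T*} = D_T T*.
  · have key : S y = q (defectOpFrom (adjoint T) y) - R (adjointDefect T hT y) := by
      refine dS.induction_on (p := fun y => S y = q (defectOpFrom (adjoint T) y) -
        R (adjointDefect T hT y)) y (isClosed_eq S.continuous (by fun_prop)) fun y => ?_
      have e1 : defectOpFrom (adjoint T) (defectOpTo (adjoint T) y) = y - T (adjoint T y) :=
        defectOp_adjoint_defectOp hT y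
      have e2 : adjointDefect T hT (defectOpTo (adjoint T) y) = defectOpTo T (adjoint T y) :=
        Subtype.ext (adjoint_map_defectOp hT y)
      rw [hS, e1, e2, hR]
      simp
    have e : u (((u.symm.toLinearIsometry.comp S).comp β.symm.toLinearIsometry) (β y)) = S y := by
      simp
    rw [e, key]
    simp [hR]
    abel

/-! ### Transfer functions -/

/-- The orthogonal projection `I - q q*` onto the orthogonal complement of the range of `q`. -/
def coproj (q : F →ₗᵢ[ℂ] K) : K →L[ℂ] K :=
  1 - q.toContinuousLinearMap ∘L adjoint q.toContinuousLinearMap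

lemma coproj_apply (q : F →ₗᵢ[ℂ] K) (v : K) :
    coproj q v = v - q (adjoint q.toContinuousLinearMap v) := rfl

lemma inner_coproj (q : F →ₗᵢ[ℂ] K) (y : F) (v : K) : inner ℂ (q y) (coproj q v) = 0 := by
  rw [coproj_apply, inner_sub_right, q.inner_map_map, adjoint_inner_right]
  exact sub_self _

lemma norm_coproj_le (q : F →ₗᵢ[ℂ] K) : ‖coproj q‖ ≤ 1 := by
  refine opNorm_le_bound _ zero_le_one fun v => ?_
  have h : ‖v‖ ^ 2 = ‖coproj q v‖ ^ 2 + ‖q (adjoint q.toContinuousLinearMap v)‖ ^ 2 := by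
    have := @norm_add_sq ℂ _ _ _ _ (q (adjoint q.toContinuousLinearMap v)) (coproj q v)
    rw [inner_coproj] at this
    rw [coproj_apply] at this ⊢
    simp at this ⊢
    linarith
  rw [one_mul]
  exact le_of_sq_le_sq (by nlinarith [sq_nonneg ‖q (adjoint q.toContinuousLinearMap v)‖])
    (norm_nonneg _)

lemma coproj_mem_residual {L : Submodule ℂ K} {q : F →ₗᵢ[ℂ] K} (hq : ∀ y, q y ∈ L) {v : K}
    (hv : v ∈ L) : coproj q v ∈ residual L q :=
  mem_residual.2 ⟨L.sub_mem hv (hq _), fun y => inner_coproj q y v⟩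

/-- The solution operator `(I - z (I - q q*) u)⁻¹`. -/
def stateResolvent (u : K ≃ₗᵢ[ℂ] K) (q : F →ₗᵢ[ℂ] K) (z : ℂ) : K →L[ℂ] K :=
  Ring.inverse (1 - z • (coproj q ∘L u.toContinuousLinearEquiv.toContinuousLinearMap))

/-- The transfer function of the colligation with channels `p` and `q`. -/
def transfer (u : K ≃ₗᵢ[ℂ] K) (p : E →ₗᵢ[ℂ] K) (q : F →ₗᵢ[ℂ] K) (z : ℂ) : E →L[ℂ] F :=
  adjoint q.toContinuousLinearMap ∘L (p.toContinuousLinearMap +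
    z • (u.toContinuousLinearEquiv.toContinuousLinearMap ∘L
      (stateResolvent u q z ∘L (coproj q ∘L p.toContinuousLinearMap))))

lemma norm_coproj_comp_le (u : K ≃ₗᵢ[ℂ] K) (q : F →ₗᵢ[ℂ] K) :
    ‖coproj q ∘L u.toContinuousLinearEquiv.toContinuousLinearMap‖ ≤ 1 := by
  refine opNorm_le_bound _ zero_le_one fun v => ?_
  have := (coproj q).le_of_opNorm_le (norm_coproj_le q) (u v)
  simpa using this

lemma norm_smul_lt_one {A : K →L[ℂ] K} (hA : ‖A‖ ≤ 1) {z : ℂ} (hz : z ∈ Metric.ball (0 : ℂ) 1) :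
    ‖z • A‖ < 1 := by
  rw [mem_ball_zero_iff] at hz
  rw [norm_smul]
  nlinarith [norm_nonneg z, norm_nonneg A]

/-- The partial sums of the Neumann series keep `v` in `L`, and `L` is closed. -/
lemma inverse_one_sub_mem {A : K →L[ℂ] K} (hA : ‖A‖ < 1) {L : Submodule ℂ K}
    (hL : IsClosed (L : Set K)) (hAL : ∀ v ∈ L, A v ∈ L) {v : K} (hv : v ∈ L) :
    Ring.inverse (1 - A) v ∈ L := by
  have h1 : HasSum (fun n : ℕ => A ^ n) (Ring.inverse (1 - A)) := by
    rw [NormedRing.inverse_one_sub A hA]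
    exact (summable_geometric_of_norm_lt_one hA).hasSum
  have h2 : HasSum (fun n : ℕ => (A ^ n) v) (Ring.inverse (1 - A) v) :=
    h1.mapL (ContinuousLinearMap.apply ℂ K v)
  refine hL.mem_of_tendsto h2 (Filter.Eventually.of_forall fun s => L.sum_mem fun n _ => ?_)
  clear h1 h2
  rename_i hn
  clear hn
  induction n with
  | zero => simpa using hv
  | succ n ih => rw [pow_succ']; exact hAL _ ih

/-- The state is v = (I - z(I - q q*)u)⁻¹(I - q q*) p x. It stays in L ⊖ ran q because u maps this
subspace into L and I - q q* maps L back to it. -/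
lemma IsStage.transfer_spec {u : K ≃ₗᵢ[ℂ] K} {L : Submodule ℂ K} {p : E →ₗᵢ[ℂ] K}
    {q : F →ₗᵢ[ℂ] K} (hs : IsStage u L p q) {z : ℂ} (hz : z ∈ Metric.ball (0 : ℂ) 1) (x : E) :
    ∃ v ∈ residual L q, p x + z • u v = q (transfer u p q z x) + v := by
  have hA := norm_smul_lt_one (norm_coproj_comp_le u q) hz
  have hunit := isUnit_one_sub_of_norm_lt_one hA
  refine ⟨stateResolvent u q z (coproj q (p x)), ?_, ?_⟩
  · refine inverse_one_sub_mem hA (isClosed_residual hs.closed q) (fun v hv => ?_)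
      (coproj_mem_residual hs.q_mem (hs.p_mem x))
    exact Submodule.smul_mem _ _
      (coproj_mem_residual hs.q_mem (mem_residual.1 ((hs.shift v).1 hv)).1)
  · set v := stateResolvent u q z (coproj q (p x)) with hv
    have h1 : v - z • coproj q (u v) = coproj q (p x) :=
      DFunLike.congr_fun (Ring.mul_inverse_cancel _ hunit) (coproj q (p x))
    have h2 : v = coproj q (p x + z • u v) := by
      rw [map_add, map_smul, ← h1]; abel
    have h3 : transfer u p q z x = adjoint q.toContinuousLinearMap (p x + z • u v) := rfl
    rw [coproj_apply, ← h3] at h2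
    exact (sub_eq_iff_eq_add'.1 h2.symm)

/-- Energy balance of the colligation: p x ⟂ u v and q y ⟂ v. -/
lemma IsStage.norm_add_sq {u : K ≃ₗᵢ[ℂ] K} {L : Submodule ℂ K} {p : E →ₗᵢ[ℂ] K}
    {q : F →ₗᵢ[ℂ] K} (hs : IsStage u L p q) {z : ℂ} {x : E} {y : F} {v : K}
    (hv : v ∈ residual L q) (h : p x + z • u v = q y + v) :
    ‖x‖ ^ 2 + ‖z‖ ^ 2 * ‖v‖ ^ 2 = ‖y‖ ^ 2 + ‖v‖ ^ 2 := by
  have h1 := (mem_residual.1 hv).2 y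
  have h2 := (mem_residual.1 ((hs.shift v).1 hv)).2 x
  have h3 := congrArg (fun w => ‖w‖ ^ 2) h
  simp only [@_root_.norm_add_sq ℂ, inner_smul_right, h1, h2, norm_smul, LinearIsometry.norm_map,
    LinearIsometryEquiv.norm_map] at h3
  simpa [mul_pow] using h3

/-- The difference of two solutions solves the equation with input 0, and for |z| < 1 the energy
balance then forces output 0. This identifies transfer functions by exhibiting any admissible state.
-/
lemma IsStage.transfer_unique {u : K ≃ₗᵢ[ℂ] K} {L : Submodule ℂ K} {p : E →ₗᵢ[ℂ] K}
    {q : F →ₗᵢ[ℂ] K} (hs : IsStage u L p q) {z : ℂ} (hz : z ∈ Metric.ball (0 : ℂ) 1) {x : E}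
    {y : F} {v : K} (hv : v ∈ residual L q) (h : p x + z • u v = q y + v) :
    transfer u p q z x = y := by
  obtain ⟨w, hw, hw'⟩ := hs.transfer_spec hz x
  have h1 : p (0 : E) + z • u (w - v) = q (transfer u p q z x - y) + (w - v) := by
    rw [map_zero, zero_add, map_sub, map_sub, smul_sub]
    have h1 : p x = q y + v - z • u v := eq_sub_of_add_eq h
    rw [h1] at hw'
    rw [sub_add_sub_comm, ← hw']
    abel
  have h2 := hs.norm_add_sq (Submodule.sub_mem _ hw hv) h1
  rw [mem_ball_zero_iff] at hz
  have h3 : ‖transfer u p q z x - y‖ ^ 2 ≤ 0 := by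
    have : ‖z‖ ^ 2 ≤ 1 := by nlinarith [norm_nonneg z]
    rw [norm_zero] at h2
    nlinarith [mul_le_mul_of_nonneg_right this (sq_nonneg ‖w - v‖)]
  exact sub_eq_zero.1 (norm_eq_zero.1 (pow_eq_zero_iff two_ne_zero |>.1 (le_antisymm h3 (sq_nonneg _))))

lemma IsStage.isSchurClass_transfer {u : K ≃ₗᵢ[ℂ] K} {L : Submodule ℂ K} {p : E →ₗᵢ[ℂ] K}
    {q : F →ₗᵢ[ℂ] K} (hs : IsStage u L p q) : IsSchurClass (transfer u p q) := by
  refine ⟨fun z hz => DifferentiableAt.differentiableWithinAt ?_, fun z hz => ?_⟩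
  · have hunit := isUnit_one_sub_of_norm_lt_one (norm_smul_lt_one (norm_coproj_comp_le u q) hz)
    have h1 : DifferentiableAt ℂ (stateResolvent u q) z :=
      DifferentiableAt.inverse (by fun_prop) hunit
    have h2 : DifferentiableAt ℂ (fun z => p.toContinuousLinearMap +
        z • (u.toContinuousLinearEquiv.toContinuousLinearMap ∘L
          (stateResolvent u q z ∘L (coproj q ∘L p.toContinuousLinearMap)))) z :=
      (differentiableAt_const _).fun_add (differentiableAt_fun_id.fun_smul
        ((differentiableAt_const _).clm_comp (h1.clm_comp (differentiableAt_const _))))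
    exact (differentiableAt_const _).clm_comp h2
  · refine opNorm_le_bound _ zero_le_one fun x => ?_
    obtain ⟨v, hv, h⟩ := hs.transfer_spec hz x
    have h2 := hs.norm_add_sq hv h
    rw [mem_ball_zero_iff] at hz
    have : ‖z‖ ^ 2 ≤ 1 := by nlinarith [norm_nonneg z]
    rw [one_mul]
    exact le_of_sq_le_sq (by nlinarith [mul_le_mul_of_nonneg_right this (sq_nonneg ‖v‖)])
      (norm_nonneg _)

lemma inner_transfer_zero (u : K ≃ₗᵢ[ℂ] K) (p : E →ₗᵢ[ℂ] K) (q : F →ₗᵢ[ℂ] K) (x : E) (y : F) :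
    inner ℂ (q y) (p x) = inner ℂ y (transfer u p q 0 x) := by
  have : transfer u p q 0 x = adjoint q.toContinuousLinearMap (p x) := by simp [transfer]
  rw [this, adjoint_inner_right]
  rfl

end Stage

/-! ### Möbius parameters of transfer functions -/

section Mobius

variable {K E F E' F' : Type*}
  [NormedAddCommGroup K] [InnerProductSpace ℂ K] [CompleteSpace K]
  [NormedAddCommGroup E] [InnerProductSpace ℂ E] [CompleteSpace E]
  [NormedAddCommGroup F] [InnerProductSpace ℂ F] [CompleteSpace F]
  [NormedAddCommGroup E'] [InnerProductSpace ℂ E'] [CompleteSpace E']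
  [NormedAddCommGroup F'] [InnerProductSpace ℂ F'] [CompleteSpace F']

lemma norm_adjointDefect_le {T : E →L[ℂ] F} (hT : ‖T‖ ≤ 1) : ‖adjointDefect T hT‖ ≤ 1 := by
  refine opNorm_le_bound _ zero_le_one fun y => ?_
  exact (adjoint T).le_of_opNorm_le (by simpa using hT) (y : F)

lemma isUnit_one_add_comp {A : F →L[ℂ] E} (hA : ‖A‖ ≤ 1) {Z : E →L[ℂ] F} (hZ : ‖Z‖ < 1) :
    IsUnit (1 + A ∘L Z) := by
  have h : ‖-(A ∘L Z)‖ < 1 := by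
    rw [norm_neg]
    refine (opNorm_comp_le _ _).trans_lt ?_
    nlinarith [norm_nonneg A, norm_nonneg Z]
  simpa using isUnit_one_sub_of_norm_lt_one h

/-- `Θ` transported to isometrically isomorphic spaces and multiplied by the variable. -/
def mulVar (α : E ≃ₗᵢ[ℂ] E') (β : F ≃ₗᵢ[ℂ] F') (Θ : ℂ → E' →L[ℂ] F') (z : ℂ) : E →L[ℂ] F :=
  z • (β.symm.toContinuousLinearEquiv.toContinuousLinearMap ∘L Θ z ∘L
    α.toContinuousLinearEquiv.toContinuousLinearMap)

lemma mulVar_apply (α : E ≃ₗᵢ[ℂ] E') (β : F ≃ₗᵢ[ℂ] F') (Θ : ℂ → E' →L[ℂ] F') (z : ℂ) (x : E) :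
    mulVar α β Θ z x = z • β.symm (Θ z (α x)) := rfl

lemma norm_mulVar_le (α : E ≃ₗᵢ[ℂ] E') (β : F ≃ₗᵢ[ℂ] F') {Θ : ℂ → E' →L[ℂ] F'}
    (hΘ : IsSchurClass Θ) {z : ℂ} (hz : z ∈ Metric.ball (0 : ℂ) 1) :
    ‖mulVar α β Θ z‖ ≤ ‖z‖ := by
  refine opNorm_le_bound _ (norm_nonneg _) fun x => ?_
  have := (Θ z).le_of_opNorm_le (hΘ.2 z hz) (α x)
  rw [mulVar_apply, norm_smul, LinearIsometryEquiv.norm_map]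
  gcongr
  simpa using this

lemma isSchurClass_mulVar (α : E ≃ₗᵢ[ℂ] E') (β : F ≃ₗᵢ[ℂ] F') {Θ : ℂ → E' →L[ℂ] F'}
    (hΘ : IsSchurClass Θ) : IsSchurClass (mulVar α β Θ) := by
  refine ⟨differentiableOn_id.fun_smul ((differentiableOn_const _).clm_comp
    (hΘ.1.clm_comp (differentiableOn_const _))), fun z hz => ?_⟩
  refine (norm_mulVar_le α β hΘ hz).trans ?_
  rw [mem_ball_zero_iff] at hz
  exact hz.le

/-- Put e = (I + T*Z)⁻¹ D_T x, so that D_T x - T*Z e = e. The rotation identity at (x, Z e),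
combined with the equation of the new stage with input e, becomes the equation of the old stage with
input x and output T x + D_{T*} Z e. -/
theorem IsStage.isMobiusParameter {u : K ≃ₗᵢ[ℂ] K} {L : Submodule ℂ K} {p : E →ₗᵢ[ℂ] K}
    {q : F →ₗᵢ[ℂ] K} (hs : IsStage u L p q) {T : E →L[ℂ] F} {hT : ‖T‖ ≤ 1}
    {α : defectSpace T ≃ₗᵢ[ℂ] E'} {β : defectSpace (adjoint T) ≃ₗᵢ[ℂ] F'}
    {p' : E' →ₗᵢ[ℂ] K} {q' : F' →ₗᵢ[ℂ] K} (hs' : IsStage u (residual L q) p' q')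
    (hrot : IsRotated u p q T hT α β p' q') (h0 : transfer u p q 0 = T) :
    IsMobiusParameter T hT (transfer u p q) (mulVar α β (transfer u p' q')) := by
  refine ⟨h0, isSchurClass_mulVar α β hs'.isSchurClass_transfer, by simp [mulVar],
    fun z hz => ContinuousLinearMap.ext fun x => ?_⟩
  have hZ : ‖mulVar α β (transfer u p' q') z‖ < 1 :=
    (norm_mulVar_le α β hs'.isSchurClass_transfer hz).trans_lt (by simpa using hz)
  have hunit := isUnit_one_add_comp (norm_adjointDefect_le hT) hZ
  set Z := mulVar α β (transfer u p' q') z with hZdef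
  set e := Ring.inverse (1 + adjointDefect T hT ∘L Z) (defectOpTo T x) with he
  have he' : e + adjointDefect T hT (Z e) = defectOpTo T x :=
    DFunLike.congr_fun (Ring.mul_inverse_cancel _ hunit) (defectOpTo T x)
  obtain ⟨v, hv, hspec⟩ := hs'.transfer_spec hz (α e)
  have hr := hrot x (Z e)
  have hβ : β (Z e) = z • transfer u p' q' z (α e) := by
    rw [hZdef, mulVar_apply, map_smul, LinearIsometryEquiv.apply_symm_apply]
  rw [← he', add_sub_cancel_right, hβ] at hr
  -- The state of the old stage is the right-hand side of the equation of the new one: its output,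
  -- embedded by `q'`, plus its state.
  have hmem : q' (transfer u p' q' z (α e)) + v ∈ residual L q :=
    Submodule.add_mem _ (hs'.q_mem _) (mem_residual.1 hv).1
  refine hs.transfer_unique hz hmem ?_
  change p x + z • u _ = q (T x + defectOpFrom (adjoint T) (Z e)) + _
  rw [← hspec, ← add_assoc, ← hr, hspec]
  simp only [map_add, map_smul, smul_add]
  abel

/-- The value of the Möbius parameter at a point is determined by that of the function. -/
lemma mobius_unique {T : E →L[ℂ] F} {hT : ‖T‖ ≤ 1}
    {Z Z' : defectSpace T →L[ℂ] defectSpace (adjoint T)} (hZ : ‖Z‖ < 1) (hZ' : ‖Z'‖ < 1)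
    (h : defectOpFrom (adjoint T) ∘L Z ∘L
        Ring.inverse (1 + adjointDefect T hT ∘L Z) ∘L defectOpTo T =
      defectOpFrom (adjoint T) ∘L Z' ∘L
        Ring.inverse (1 + adjointDefect T hT ∘L Z') ∘L defectOpTo T) : Z = Z' := by
  have hu := isUnit_one_add_comp (norm_adjointDefect_le hT) hZ
  have hu' := isUnit_one_add_comp (norm_adjointDefect_le hT) hZ'
  set A := adjointDefect T hT
  set R := Ring.inverse (1 + A ∘L Z)
  set R' := Ring.inverse (1 + A ∘L Z')
  -- D_{T*} cancels on the left by injectivity on the defect space, D_T on the right by density of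
  -- its range.
  have hQ : Z ∘L R = Z' ∘L R' := by
    refine DFunLike.coe_injective ((denseRange_defectOpTo T).equalizer
      (ContinuousLinearMap.continuous _) (ContinuousLinearMap.continuous _) (funext fun x => ?_))
    exact defectOpFrom_injective (DFunLike.congr_fun h x)
  have h1 : R + A ∘L (Z ∘L R) = 1 := Ring.mul_inverse_cancel _ hu
  have h1' : R' + A ∘L (Z' ∘L R') = 1 := Ring.mul_inverse_cancel _ hu'
  -- The common value Q = Z R determines R = I - A Q, and then Z = Q R⁻¹.
  have hR : R = R' := by
    rw [hQ] at h1
    exact add_right_cancel (h1.trans h1'.symm)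
  have h2 : R * (1 + A ∘L Z) = 1 := Ring.inverse_mul_cancel _ hu
  have h2' : R' * (1 + A ∘L Z') = 1 := Ring.inverse_mul_cancel _ hu'
  have h3 : (1 : defectSpace T →L[ℂ] defectSpace T) + A ∘L Z = 1 + A ∘L Z' := by
    have h4 : (1 + A ∘L Z) * R = 1 := Ring.mul_inverse_cancel _ hu
    rw [← hR] at h2'
    exact left_inv_eq_right_inv h4 h2'
  calc Z = Z ∘L (R * (1 + A ∘L Z)) := by rw [h2]; rfl
    _ = (Z ∘L R) ∘L (1 + A ∘L Z) := rfl
    _ = (Z' ∘L R') ∘L (1 + A ∘L Z') := by rw [hQ, h3]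
    _ = Z' ∘L (R' * (1 + A ∘L Z')) := rfl
    _ = Z' := by rw [h2']; rfl

lemma eq_at_zero_of_eqOn {G : Type*} [NormedAddCommGroup G] [NormedSpace ℂ G] {f g : ℂ → G}
    (hf : ContinuousAt f 0) (hg : ContinuousAt g 0)
    (h : ∀ z ∈ Metric.ball (0 : ℂ) 1, z ≠ 0 → f z = g z) : f 0 = g 0 := by
  refine tendsto_nhds_unique_of_eventuallyEq (hf.tendsto.mono_left nhdsWithin_le_nhds)
    (hg.tendsto.mono_left (nhdsWithin_le_nhds (s := {0}ᶜ))) ?_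
  filter_upwards [self_mem_nhdsWithin,
    nhdsWithin_le_nhds (Metric.ball_mem_nhds (0 : ℂ) one_pos)] with z hz hz'
  exact h z hz' hz

lemma IsSchurClass.continuousAt_zero {Θ : ℂ → E →L[ℂ] F} (h : IsSchurClass Θ) :
    ContinuousAt Θ 0 :=
  (h.1.differentiableAt (Metric.ball_mem_nhds (0 : ℂ) one_pos)).continuousAt

/-- The Schur iterate is determined by the function. -/
lemma iterate_unique {T : E →L[ℂ] F} {hT : ‖T‖ ≤ 1} {Θ Θ' : ℂ → E →L[ℂ] F}
    {α : defectSpace T ≃ₗᵢ[ℂ] E'} {β : defectSpace (adjoint T) ≃ₗᵢ[ℂ] F'}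
    {Φ Φ' : ℂ → E' →L[ℂ] F'} (hΘ : ∀ z ∈ Metric.ball (0 : ℂ) 1, Θ z = Θ' z)
    (hΦ : IsSchurClass Φ) (hΦ' : IsSchurClass Φ')
    (h : IsMobiusParameter T hT Θ (mulVar α β Φ)) (h' : IsMobiusParameter T hT Θ' (mulVar α β Φ'))
    {z : ℂ} (hz : z ∈ Metric.ball (0 : ℂ) 1) : Φ z = Φ' z := by
  have key : ∀ z ∈ Metric.ball (0 : ℂ) 1, z ≠ 0 → Φ z = Φ' z := fun z hz hz0 => by
    have hlt : ‖z‖ < 1 := by simpa using hz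
    have h1 : mulVar α β Φ z = mulVar α β Φ' z := by
      refine mobius_unique (hT := hT) ((norm_mulVar_le α β hΦ hz).trans_lt hlt)
        ((norm_mulVar_le α β hΦ' hz).trans_lt hlt) ?_
      have := (h.2.2.2 z hz).symm.trans ((hΘ z hz).trans (h'.2.2.2 z hz))
      exact add_left_cancel this
    ext x
    have h2 := DFunLike.congr_fun h1 (α.symm x)
    simpa [mulVar_apply, hz0] using h2
  -- The factor z carries no information at the origin, where continuity decides.
  by_cases hz0 : z = 0
  · rw [hz0]
    exact eq_at_zero_of_eqOn hΦ.continuousAt_zero hΦ'.continuousAt_zero key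
  · exact key z hz hz0

end Mobius

/-! ### The Schur function of a cyclic subspace as a transfer function -/

section Initial

variable {K : Type*} [NormedAddCommGroup K] [InnerProductSpace ℂ K] [CompleteSpace K]

/-- A unitary operator as an isometric isomorphism. -/
def unitaryEquiv (U : unitary (K →L[ℂ] K)) : K ≃ₗᵢ[ℂ] K := Unitary.linearIsometryEquiv U

lemma unitaryEquiv_apply (U : unitary (K →L[ℂ] K)) (x : K) :
    unitaryEquiv U x = (U : K →L[ℂ] K) x := rfl

/-- The restriction of a unitary operator to a subspace, as an isometry. -/
def inChannel (u : K ≃ₗᵢ[ℂ] K) (𝔐 : Submodule ℂ K) : 𝔐 →ₗᵢ[ℂ] K :=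
  u.toLinearIsometry.comp 𝔐.subtypeₗᵢ

/-- Here the two residual subspaces are 𝔐^⊥ and (u𝔐)^⊥, which u matches because it preserves inner
products. -/
lemma isStage_top (u : K ≃ₗᵢ[ℂ] K) (𝔐 : Submodule ℂ K) [CompleteSpace 𝔐] :
    IsStage u ⊤ (inChannel u 𝔐) 𝔐.subtypeₗᵢ where
  closed := isClosed_univ
  p_mem _ := Submodule.mem_top
  q_mem _ := Submodule.mem_top
  shift v := by
    rw [mem_residual, mem_residual]
    have h : ∀ x : 𝔐, inner ℂ (inChannel u 𝔐 x) (u v) = inner ℂ (𝔐.subtypeₗᵢ x) v :=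
      fun x => u.inner_map_map x v
    simp only [h, Submodule.mem_top]

variable (U : unitary (K →L[ℂ] K)) (𝔐 : Submodule ℂ K) [CompleteSpace 𝔐]

lemma norm_smul_unitary_lt_one (V : unitary (K →L[ℂ] K)) {z : ℂ}
    (hz : z ∈ Metric.ball (0 : ℂ) 1) : ‖z • (V : K →L[ℂ] K)‖ < 1 := by
  refine norm_smul_lt_one (opNorm_le_bound _ zero_le_one fun v => ?_) hz
  rw [one_mul, ← unitaryEquiv_apply, LinearIsometryEquiv.norm_map]

lemma isUnit_sub_smul {z : ℂ} (hz : z ∈ Metric.ball (0 : ℂ) 1) :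
    IsUnit ((U : K →L[ℂ] K) - z • 1) := by
  have h : (U : K →L[ℂ] K) - z • 1 = U * (1 - z • ((star U : unitary (K →L[ℂ] K)) : K →L[ℂ] K)) := by
    rw [mul_sub, mul_smul_comm, mul_one, Unitary.coe_mul_star_self]
  rw [h]
  exact (Unitary.toUnits U).isUnit.mul
    (isUnit_one_sub_of_norm_lt_one (norm_smul_unitary_lt_one (star U) hz))

/-- Since U* - z = U*(I - zU), one has (U* - z)⁻¹(U* + z) = 2(I - zU)⁻¹ - I; compress to 𝔐. -/
lemma caratheodoryAdj_add_one {z : ℂ} (hz : z ∈ Metric.ball (0 : ℂ) 1) :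
    caratheodoryAdj U 𝔐 z + 1 = (2 : ℂ) • (𝔐.orthogonalProjectionOnto ∘L
      Ring.inverse (1 - z • (U : K →L[ℂ] K)) ∘L 𝔐.subtypeL) := by
  have hz' : starRingEnd ℂ z ∈ Metric.ball (0 : ℂ) 1 := by simpa using hz
  set R := Ring.inverse (1 - z • (U : K →L[ℂ] K)) with hR
  have hunit := isUnit_one_sub_of_norm_lt_one (norm_smul_unitary_lt_one U hz)
  have h1 : star (((U : K →L[ℂ] K) + starRingEnd ℂ z • 1) *
      Ring.inverse ((U : K →L[ℂ] K) - starRingEnd ℂ z • 1)) = (2 : ℂ) • R - 1 := by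
    have hu : IsUnit (star (U : K →L[ℂ] K) - z • 1) := by
      simpa using (isUnit_sub_smul U hz').star
    have h2 : star (U : K →L[ℂ] K) + z • 1 = (star (U : K →L[ℂ] K) - z • 1) * ((2 : ℂ) • R - 1) := by
      have h3 : (star (U : K →L[ℂ] K) - z • 1) = star (U : K →L[ℂ] K) * (1 - z • (U : K →L[ℂ] K)) := by
        rw [mul_sub, mul_smul_comm, mul_one, Unitary.coe_star_mul_self]
      rw [mul_sub, mul_smul_comm, mul_one]
      have h4 : (star (U : K →L[ℂ] K) - z • 1) * R = star (U : K →L[ℂ] K) := by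
        rw [h3, mul_assoc, Ring.mul_inverse_cancel _ hunit, mul_one]
      rw [h4, two_smul]
      abel
    rw [star_mul, ← Ring.inverse_star]
    have h4 : star ((U : K →L[ℂ] K) - starRingEnd ℂ z • 1) = star (U : K →L[ℂ] K) - z • 1 := by
      simp
    have h5 : star ((U : K →L[ℂ] K) + starRingEnd ℂ z • 1) = star (U : K →L[ℂ] K) + z • 1 := by
      simp
    rw [h4, h5, h2, Ring.inverse_mul_cancel_left _ _ hu]
  have h6 : caratheodoryAdj U 𝔐 z = 𝔐.orthogonalProjectionOnto ∘L ((2 : ℂ) • R - 1) ∘L 𝔐.subtypeL := by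
    rw [← h1, caratheodoryAdj, caratheodory, adjoint_comp, adjoint_comp, star_eq_adjoint,
      Submodule.adjoint_subtypeL, Submodule.adjoint_orthogonalProjectionOnto]
    rfl
  rw [h6]
  ext x
  simp

/-- The transfer function of the colligation given by `U` and the subspace `𝔐`. -/
abbrev initialTransfer : ℂ → 𝔐 →L[ℂ] 𝔐 :=
  transfer (unitaryEquiv U) (inChannel (unitaryEquiv U) 𝔐) 𝔐.subtypeₗᵢ

lemma isSchurClass_initialTransfer : IsSchurClass (initialTransfer U 𝔐) :=
  (isStage_top (unitaryEquiv U) 𝔐).isSchurClass_transfer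

/-- With t = Θ(z)x, the colligation equation U(x + zv) = t + v gives (I - zU)(x + zv) = x - zt.
Since v ⟂ 𝔐, projecting (I - zU)⁻¹(x - zt) = x + zv to 𝔐 leaves x. -/
lemma caratheodoryAdj_add_one_apply {z : ℂ} (hz : z ∈ Metric.ball (0 : ℂ) 1) (x : 𝔐) :
    (caratheodoryAdj U 𝔐 z + 1) (x - z • initialTransfer U 𝔐 z x) = (2 : ℂ) • x := by
  have hunit := isUnit_one_sub_of_norm_lt_one (norm_smul_unitary_lt_one U hz)
  rw [caratheodoryAdj_add_one U 𝔐 hz]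
  obtain ⟨v, hv, h⟩ := (isStage_top (unitaryEquiv U) 𝔐).transfer_spec hz x
  set t := initialTransfer U 𝔐 z x with ht
  have hv' : 𝔐.orthogonalProjectionOnto v = 0 := by
    rw [Submodule.orthogonalProjectionOnto_eq_zero_iff, Submodule.mem_orthogonal]
    exact fun w hw => (mem_residual.1 hv).2 ⟨w, hw⟩
  have h1 : (U : K →L[ℂ] K) x + z • (U : K →L[ℂ] K) v = t + v := h
  have h2 : (1 - z • (U : K →L[ℂ] K)) (x + z • v) = x - z • (t : K) := by
    have : (U : K →L[ℂ] K) (x + z • v) = t + v := by rw [map_add, map_smul, h1]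
    rw [sub_apply, smul_apply, this, one_apply_eq_self, smul_add]
    abel
  have h3 : Ring.inverse (1 - z • (U : K →L[ℂ] K)) (x - z • (t : K)) = x + z • v := by
    rw [← h2]
    exact DFunLike.congr_fun (Ring.inverse_mul_cancel _ hunit) (x + z • v)
  change (2 : ℂ) • 𝔐.orthogonalProjectionOnto
    (Ring.inverse (1 - z • (U : K →L[ℂ] K)) (x - z • (t : K))) = _
  rw [h3, map_add, map_smul, hv', smul_zero, add_zero,
    Submodule.orthogonalProjectionOnto_mem_subspace_eq_self]

/-- The right inverse (I - zΘ)/2 of C + I is itself invertible because ‖zΘ‖ < 1, so it is the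
inverse; then (C - I)(C + I)⁻¹ = I - 2(C + I)⁻¹. -/
lemma cayley_transform {E : Type*} [NormedAddCommGroup E] [InnerProductSpace ℂ E] [CompleteSpace E]
    {C Θ : E →L[ℂ] E} {z : ℂ} (hz : z ∈ Metric.ball (0 : ℂ) 1) (hΘ : ‖Θ‖ ≤ 1)
    (h : ∀ x, (C + 1) (x - z • Θ x) = (2 : ℂ) • x) :
    IsUnit (C + 1) ∧ (C - 1) * Ring.inverse (C + 1) = z • Θ := by
  have hmul : (C + 1) * ((2⁻¹ : ℂ) • (1 - z • Θ)) = 1 := by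
    have : (C + 1) * (1 - z • Θ) = (2 : ℂ) • 1 := ContinuousLinearMap.ext h
    rw [mul_smul_comm, this, smul_smul]
    norm_num
  have hX : IsUnit ((2⁻¹ : ℂ) • (1 - z • Θ)) :=
    (isUnit_one_sub_of_norm_lt_one (norm_smul_lt_one hΘ hz)).smul
      (Units.mk0 (2⁻¹ : ℂ) (by norm_num))
  have hC : IsUnit (C + 1) := by
    obtain ⟨X, hX⟩ := hX
    rw [← hX] at hmul
    rw [Units.mul_eq_one_iff_eq_inv.1 hmul]
    exact (X⁻¹).isUnit
  have hinv : Ring.inverse (C + 1) = (2⁻¹ : ℂ) • (1 - z • Θ) := by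
    rw [← Ring.inverse_mul_cancel_left (C + 1) ((2⁻¹ : ℂ) • (1 - z • Θ)) hC, hmul, mul_one]
  refine ⟨hC, ?_⟩
  have h1 : C - 1 = (C + 1) - (2 : ℂ) • 1 := by
    rw [two_smul]; abel
  rw [h1, sub_mul, Ring.mul_inverse_cancel _ hC, hinv, smul_mul_assoc, one_mul, smul_smul]
  norm_num

lemma caratheodoryAdj_cayley {z : ℂ} (hz : z ∈ Metric.ball (0 : ℂ) 1) :
    IsUnit (caratheodoryAdj U 𝔐 z + 1) ∧
      (caratheodoryAdj U 𝔐 z - 1) * Ring.inverse (caratheodoryAdj U 𝔐 z + 1) =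
        z • initialTransfer U 𝔐 z :=
  cayley_transform hz ((isSchurClass_initialTransfer U 𝔐).2 z hz)
    (caratheodoryAdj_add_one_apply U 𝔐 hz)

lemma schurFunction_eq {z : ℂ} (hz : z ∈ Metric.ball (0 : ℂ) 1) :
    schurFunction U 𝔐 z = initialTransfer U 𝔐 z := by
  have key : ∀ z ∈ Metric.ball (0 : ℂ) 1, z ≠ 0 →
      z⁻¹ • ((caratheodoryAdj U 𝔐 z - 1) * Ring.inverse (caratheodoryAdj U 𝔐 z + 1)) =
        initialTransfer U 𝔐 z := fun z hz hz0 => by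
    rw [(caratheodoryAdj_cayley U 𝔐 hz).2]
    exact inv_smul_smul₀ hz0 (initialTransfer U 𝔐 z)
  by_cases hz0 : z = 0
  · subst hz0
    rw [schurFunction, Function.update_self]
    -- The limit exists because off the origin the quotient equals the transfer function, which is
    -- continuous at 0.
    refine Filter.Tendsto.limUnder_eq ?_
    refine Filter.Tendsto.congr' (f₁ := initialTransfer U 𝔐) ?_
      ((isSchurClass_initialTransfer U 𝔐).continuousAt_zero.tendsto.mono_left nhdsWithin_le_nhds)
    filter_upwards [self_mem_nhdsWithin,
      nhdsWithin_le_nhds (Metric.ball_mem_nhds (0 : ℂ) one_pos)] with z hz hz'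
    exact (key z hz' hz).symm
  · rw [schurFunction, Function.update_of_ne hz0]
    exact key z hz hz0

lemma isSchurClass_schurFunction : IsSchurClass (schurFunction U 𝔐) :=
  ⟨(isSchurClass_initialTransfer U 𝔐).1.congr fun _ hz => schurFunction_eq U 𝔐 hz,
    fun z hz => by
      rw [schurFunction_eq U 𝔐 hz]
      exact (isSchurClass_initialTransfer U 𝔐).2 z hz⟩

end Initial

/-! ### Existence of the Schur parameters -/

section Existence

variable {K E F E' F' : Type*}
  [NormedAddCommGroup K] [InnerProductSpace ℂ K] [CompleteSpace K]
  [NormedAddCommGroup E] [InnerProductSpace ℂ E] [CompleteSpace E]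
  [NormedAddCommGroup F] [InnerProductSpace ℂ F] [CompleteSpace F]
  [NormedAddCommGroup E'] [InnerProductSpace ℂ E'] [CompleteSpace E']
  [NormedAddCommGroup F'] [InnerProductSpace ℂ F'] [CompleteSpace F']

lemma residual_comp (L : Submodule ℂ K) (q : F →ₗᵢ[ℂ] K) (b : F' ≃ₗᵢ[ℂ] F) :
    residual L (q.comp b.toLinearIsometry) = residual L q := by
  ext v
  rw [mem_residual, mem_residual]
  exact and_congr_right fun _ => (b.surjective.forall (p := fun y => inner ℂ (q y) v = 0)).symm

/-- Needed because a choice sequence starts from the subspaces `⊤` of `M` and `N`, not from `M` and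
`N` themselves. -/
lemma IsStage.comp {u : K ≃ₗᵢ[ℂ] K} {L : Submodule ℂ K} {p : E →ₗᵢ[ℂ] K} {q : F →ₗᵢ[ℂ] K}
    (hs : IsStage u L p q) (a : E' ≃ₗᵢ[ℂ] E) (b : F' ≃ₗᵢ[ℂ] F) :
    IsStage u L (p.comp a.toLinearIsometry) (q.comp b.toLinearIsometry) where
  closed := hs.closed
  p_mem _ := hs.p_mem _
  q_mem _ := hs.q_mem _
  shift v := by rw [residual_comp, residual_comp]; exact hs.shift v

lemma IsStage.transfer_comp {u : K ≃ₗᵢ[ℂ] K} {L : Submodule ℂ K} {p : E →ₗᵢ[ℂ] K}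
    {q : F →ₗᵢ[ℂ] K} (hs : IsStage u L p q) (a : E' ≃ₗᵢ[ℂ] E) (b : F' ≃ₗᵢ[ℂ] F) {z : ℂ}
    (hz : z ∈ Metric.ball (0 : ℂ) 1) (x : E') :
    b (transfer u (p.comp a.toLinearIsometry) (q.comp b.toLinearIsometry) z x) =
      transfer u p q z (a x) := by
  obtain ⟨v, hv, h⟩ := hs.transfer_spec hz (a x)
  rw [(hs.comp a b).transfer_unique hz (y := b.symm (transfer u p q z (a x))) (v := v)
    (by rwa [residual_comp]) (by simpa using h), LinearIsometryEquiv.apply_symm_apply]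

lemma completeSpace_map_subtype {M : Type*} [NormedAddCommGroup M] [InnerProductSpace ℂ M]
    {P : Submodule ℂ M} (S : Submodule ℂ P) [CompleteSpace S] :
    CompleteSpace (S.map P.subtype) :=
  (completeSpace_congr (e := (liftSubspace S rfl).toLinearEquiv.toEquiv)
    (liftSubspace S rfl).isometry.isUniformEmbedding).1 inferInstance

variable (M N : Type*)
  [NormedAddCommGroup M] [InnerProductSpace ℂ M] [CompleteSpace M]
  [NormedAddCommGroup N] [InnerProductSpace ℂ N] [CompleteSpace N]

/-- A stage of the geometric Schur algorithm whose channel spaces are subspaces of `M` and `N`. -/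
structure StageData (u : K ≃ₗᵢ[ℂ] K) where
  X : Submodule ℂ M
  Y : Submodule ℂ N
  [completeX : CompleteSpace X]
  [completeY : CompleteSpace Y]
  L : Submodule ℂ K
  p : X →ₗᵢ[ℂ] K
  q : Y →ₗᵢ[ℂ] K
  stage : IsStage u L p q

attribute [instance] StageData.completeX StageData.completeY

namespace StageData

variable {M N} {u : K ≃ₗᵢ[ℂ] K}

/-- The value of the transfer function at the origin. -/
def op (d : StageData M N u) : d.X →L[ℂ] d.Y := transfer u d.p d.q 0

lemma norm_op_le (d : StageData M N u) : ‖d.op‖ ≤ 1 :=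
  d.stage.isSchurClass_transfer.2 0 (by simp)

lemma exists_next (d : StageData M N u) : ∃ d' : StageData M N u,
    ∃ (hX : d'.X = (defectSpace d.op).map d.X.subtype)
      (hY : d'.Y = (defectSpace (adjoint d.op)).map d.Y.subtype),
      d'.L = residual d.L d.q ∧
      IsRotated u d.p d.q d.op d.norm_op_le (liftSubspace _ hX) (liftSubspace _ hY) d'.p d'.q := by
  have := completeSpace_map_subtype (defectSpace d.op)
  have := completeSpace_map_subtype (defectSpace (adjoint d.op))
  obtain ⟨p', q', hs, hrot⟩ := d.stage.exists_next d.norm_op_le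
    (fun x y => inner_transfer_zero u d.p d.q x y)
    (liftSubspace (defectSpace d.op) rfl) (liftSubspace (defectSpace (adjoint d.op)) rfl)
  exact ⟨{ X := _, Y := _, L := _, p := p', q := q', stage := hs }, rfl, rfl, rfl, hrot⟩

/-- The next stage. -/
def next (d : StageData M N u) : StageData M N u := d.exists_next.choose

/-- The stages that follow `d`. -/
def iter (d : StageData M N u) : ℕ → StageData M N u
  | 0 => d
  | n + 1 => (d.iter n).next

lemma isMobiusParameter (d : StageData M N u) :
    ∃ (hX : d.next.X = (defectSpace d.op).map d.X.subtype)
      (hY : d.next.Y = (defectSpace (adjoint d.op)).map d.Y.subtype),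
      IsMobiusParameter d.op d.norm_op_le (transfer u d.p d.q)
        (mulVar (liftSubspace _ hX) (liftSubspace _ hY) (transfer u d.next.p d.next.q)) := by
  obtain ⟨hX, hY, hL, hrot⟩ := d.exists_next.choose_spec
  exact ⟨hX, hY, d.stage.isMobiusParameter (hL ▸ d.next.stage) hrot rfl⟩

/-- The choice sequence of the values at the origin of the transfer functions. -/
def choiceSequence (d : StageData M N u) (hX : d.X = ⊤) (hY : d.Y = ⊤) : ChoiceSequence M N where
  X n := (d.iter n).X
  Y n := (d.iter n).Y
  op n := (d.iter n).op
  contractive n := (d.iter n).norm_op_le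
  X_zero := hX
  Y_zero := hY
  X_succ n := (d.iter n).isMobiusParameter.choose
  Y_succ n := (d.iter n).isMobiusParameter.choose_spec.choose

lemma isSchurParameters (d : StageData M N u) (hX : d.X = ⊤) (hY : d.Y = ⊤) {Θ : ℂ → M →L[ℂ] N}
    (h : ∀ z ∈ Metric.ball (0 : ℂ) 1, ∀ x, (transfer u d.p d.q z x : N) = Θ z x) :
    (d.choiceSequence hX hY).IsSchurParameters Θ :=
  ⟨fun n => transfer u (d.iter n).p (d.iter n).q, h,
    fun n => (d.iter n).stage.isSchurClass_transfer,
    fun n => (d.iter n).isMobiusParameter.choose_spec.choose_spec⟩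

end StageData

variable {M N}

lemma IsStage.exists_isSchurParameters {u : K ≃ₗᵢ[ℂ] K} {L : Submodule ℂ K} {p : M →ₗᵢ[ℂ] K}
    {q : N →ₗᵢ[ℂ] K} (hs : IsStage u L p q) {Θ : ℂ → M →L[ℂ] N}
    (hΘ : ∀ z ∈ Metric.ball (0 : ℂ) 1, Θ z = transfer u p q z) :
    ∃ Γ : ChoiceSequence M N, Γ.IsSchurParameters Θ := by
  have : CompleteSpace (⊤ : Submodule ℂ M) := isClosed_univ.completeSpace_coe
  have : CompleteSpace (⊤ : Submodule ℂ N) := isClosed_univ.completeSpace_coe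
  let a := LinearIsometryEquiv.ofTop M (⊤ : Submodule ℂ M) rfl
  let b := LinearIsometryEquiv.ofTop N (⊤ : Submodule ℂ N) rfl
  let d : StageData M N u := { X := ⊤, Y := ⊤, L := L, p := _, q := _, stage := hs.comp a b }
  exact ⟨d.choiceSequence rfl rfl, d.isSchurParameters rfl rfl fun z hz x => by
    rw [hΘ z hz]
    exact hs.transfer_comp a b hz x⟩

theorem exists_isSchurParameters (U : unitary (K →L[ℂ] K)) (𝔐 : Submodule ℂ K) [CompleteSpace 𝔐] :
    ∃ Γ : ChoiceSequence 𝔐 𝔐, Γ.IsSchurParameters (schurFunction U 𝔐) :=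
  (isStage_top (unitaryEquiv U) 𝔐).exists_isSchurParameters fun _ hz => schurFunction_eq U 𝔐 hz

/-! ### The stages along a sequence of Schur parameters -/

/-- The stages of the geometric Schur algorithm along a choice sequence. -/
structure IsChain (Γ : ChoiceSequence M N) (u : K ≃ₗᵢ[ℂ] K) (L : ℕ → Submodule ℂ K)
    (p : ∀ n, Γ.X n →ₗᵢ[ℂ] K) (q : ∀ n, Γ.Y n →ₗᵢ[ℂ] K) : Prop where
  stage : ∀ n, IsStage u (L n) (p n) (q n)
  succ : ∀ n, L (n + 1) = residual (L n) (q n)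
  rotated : ∀ n, IsRotated u (p n) (q n) (Γ.op n) (Γ.contractive n) (Γ.idX n) (Γ.idY n)
    (p (n + 1)) (q (n + 1))

/-- The given iterates, not the geometry, fix the operators `Γ.op n`; uniqueness of the iterates
keeps the transfer functions of the constructed stages equal to them. -/
theorem ChoiceSequence.IsSchurParameters.exists_isChain {Γ : ChoiceSequence M N}
    {Θ : ℂ → M →L[ℂ] N} (h : Γ.IsSchurParameters Θ) {u : K ≃ₗᵢ[ℂ] K} {L : Submodule ℂ K}
    {p : M →ₗᵢ[ℂ] K} {q : N →ₗᵢ[ℂ] K} (hs : IsStage u L p q)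
    (hΘ : ∀ z ∈ Metric.ball (0 : ℂ) 1, Θ z = transfer u p q z) :
    ∃ Ls ps qs, IsChain Γ u Ls ps qs ∧ (∀ x, ps 0 x = p x) ∧ ∀ y, qs 0 y = q y := by
  obtain ⟨it, h0, hit, hmob⟩ := h
  let a := LinearIsometryEquiv.ofTop M (Γ.X 0) Γ.X_zero
  let b := LinearIsometryEquiv.ofTop N (Γ.Y 0) Γ.Y_zero
  -- The agreement with `it n` is carried as induction hypothesis: at z = 0 it yields q* p = Γ_n,
  -- which the next step requires.
  let D : ℕ → Type _ := fun n => { d : Submodule ℂ K × (Γ.X n →ₗᵢ[ℂ] K) × (Γ.Y n →ₗᵢ[ℂ] K) //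
    IsStage u d.1 d.2.1 d.2.2 ∧ ∀ z ∈ Metric.ball (0 : ℂ) 1, transfer u d.2.1 d.2.2 z = it n z }
  have step : ∀ n (d : D n), ∃ d' : D (n + 1), d'.1.1 = residual d.1.1 d.1.2.2 ∧
      IsRotated u d.1.2.1 d.1.2.2 (Γ.op n) (Γ.contractive n) (Γ.idX n) (Γ.idY n)
        d'.1.2.1 d'.1.2.2 := by
    rintro n ⟨⟨L, p, q⟩, hs, ht⟩
    have hT : transfer u p q 0 = Γ.op n := (ht 0 (by simp)).trans (hmob n).1
    obtain ⟨p', q', hs', hrot⟩ := hs.exists_next (Γ.contractive n)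
      (fun x y => by rw [← hT]; exact inner_transfer_zero u p q x y) (Γ.idX n) (Γ.idY n)
    refine ⟨⟨⟨residual L q, p', q'⟩, hs', fun z hz => ?_⟩, rfl, hrot⟩
    exact iterate_unique ht hs'.isSchurClass_transfer (hit (n + 1))
      (hs.isMobiusParameter hs' hrot hT) (hmob n) hz
  have start : ∀ z ∈ Metric.ball (0 : ℂ) 1,
      transfer u (p.comp a.toLinearIsometry) (q.comp b.toLinearIsometry) z = it 0 z := by
    refine fun z hz => ContinuousLinearMap.ext fun x => Subtype.ext ?_
    rw [h0 z hz, hΘ z hz]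
    exact hs.transfer_comp a b hz x
  let d : ∀ n, D n := fun n =>
    Nat.rec (motive := D) ⟨⟨L, _, _⟩, hs.comp a b, start⟩ (fun n d => (step n d).choose) n
  exact ⟨fun n => (d n).1.1, fun n => (d n).1.2.1, fun n => (d n).1.2.2,
    ⟨fun n => (d n).2.1, fun n => (step n (d n)).choose_spec.1,
      fun n => (step n (d n)).choose_spec.2⟩, fun _ => rfl, fun _ => rfl⟩

end Existence

/-! ### Block operator CMV matrices on the summands -/

section Single

variable {A B : ℕ → Type*}
  [∀ n, NormedAddCommGroup (A n)] [∀ n, InnerProductSpace ℂ (A n)]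
  [∀ n, NormedAddCommGroup (B n)] [∀ n, InnerProductSpace ℂ (B n)]

lemma regroup_left (a : A 0) :
    regroup A B (WithLp.toLp 2 (a, 0)) = lp.single (E := fun n => WithLp 2 (A n × B n)) 2 0 (WithLp.toLp 2 (a, 0)) := by
  refine lp.ext (funext fun j => ?_)
  cases j with
  | zero => rw [lp.single_apply_self]; rfl
  | succ k => rw [lp.single_apply_ne 2 0 _ (Nat.succ_ne_zero k)]; rfl

/-- Moving the brackets splits one summand between two consecutive pairs; this overlap makes the CMV
matrix non-diagonal. -/
lemma regroup_right_single (n : ℕ) (w : WithLp 2 (B n × A (n + 1))) :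
    regroup A B (WithLp.toLp 2 (0, lp.single 2 n w)) =
      lp.single 2 n (WithLp.toLp 2 (0, w.fst)) +
        lp.single 2 (n + 1) (WithLp.toLp 2 (w.snd, 0)) := by
  refine lp.ext (funext fun j => ?_)
  rw [lp.coeFn_add, Pi.add_apply]
  refine WithLp.ofLp_injective 2 (Prod.ext ?_ ?_)
  · rw [WithLp.ofLp_add, Prod.fst_add]
    have h1 : (lp.single (E := fun n => WithLp 2 (A n × B n)) 2 n
        (WithLp.toLp 2 (0, w.fst)) j).ofLp.1 = 0 := by
      by_cases h : j = n
      · subst h; rw [lp.single_apply_self]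
      · rw [lp.single_apply_ne _ _ _ h]; rfl
    rw [h1, zero_add]
    cases j with
    | zero => rw [lp.single_apply_ne _ _ _ (Nat.succ_ne_zero n).symm]; rfl
    | succ k =>
      change (lp.single (E := fun n => WithLp 2 (B n × A (n + 1))) 2 n w k).snd = _
      by_cases h : k = n
      · subst h; rw [lp.single_apply_self, lp.single_apply_self]
      · rw [lp.single_apply_ne _ _ _ h, lp.single_apply_ne _ _ _ (by omega)]; rfl
  · rw [WithLp.ofLp_add, Prod.snd_add]
    have h1 : (lp.single (E := fun n => WithLp 2 (A n × B n)) 2 (n + 1)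
        (WithLp.toLp 2 (w.snd, 0)) j).ofLp.2 = 0 := by
      by_cases h : j = n + 1
      · subst h; rw [lp.single_apply_self]
      · rw [lp.single_apply_ne _ _ _ h]; rfl
    rw [h1, add_zero]
    have h2 : (regroup A B (WithLp.toLp 2 (0, lp.single 2 n w)) j).ofLp.2 =
        (lp.single (E := fun n => WithLp 2 (B n × A (n + 1))) 2 n w j).fst := by
      cases j <;> rfl
    rw [h2]
    by_cases h : j = n
    · subst h; rw [lp.single_apply_self, lp.single_apply_self]
    · rw [lp.single_apply_ne _ _ _ h, lp.single_apply_ne _ _ _ h]; rfl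

variable {C D : ℕ → Type*}
  [∀ n, NormedAddCommGroup (C n)] [∀ n, InnerProductSpace ℂ (C n)]
  [∀ n, NormedAddCommGroup (D n)] [∀ n, InnerProductSpace ℂ (D n)]

lemma mapCLM_single (T : ∀ n, C n →L[ℂ] D n) {k : ℝ} (hk : 0 ≤ k) (hT : ∀ n, ‖T n‖ ≤ k) (n : ℕ)
    (w : C n) : lp.mapCLM 2 T hk hT (lp.single 2 n w) = lp.single 2 n (T n w) := by
  refine lp.ext (funext fun j => ?_)
  rw [lp.mapCLM_apply_coe]
  by_cases h : j = n
  · subst h; rw [lp.single_apply_self, lp.single_apply_self]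
  · rw [lp.single_apply_ne _ _ _ h, lp.single_apply_ne _ _ _ h, map_zero]

lemma norm_mapCLM (T : ∀ n, C n →L[ℂ] D n) {k : ℝ} (hk : 0 ≤ k) (hT : ∀ n, ‖T n‖ ≤ k)
    (hiso : ∀ n x, ‖T n x‖ = ‖x‖) (f : lp C 2) : ‖lp.mapCLM 2 T hk hT f‖ = ‖f‖ := by
  have h1 := lp.hasSum_norm (p := 2) (by norm_num) (lp.mapCLM 2 T hk hT f)
  have h2 := lp.hasSum_norm (p := 2) (by norm_num) f
  have h3 : ∀ n, ‖lp.mapCLM 2 T hk hT f n‖ = ‖f n‖ := fun n => by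
    rw [lp.mapCLM_apply_coe, hiso]
  simp only [h3] at h1
  have := h1.unique h2
  refine (sq_eq_sq₀ (norm_nonneg _) (norm_nonneg _)).1 ?_
  simpa using this

lemma mapCLM_surjective (T : ∀ n, C n →L[ℂ] D n) {k : ℝ} (hk : 0 ≤ k) (hT : ∀ n, ‖T n‖ ≤ k)
    (hiso : ∀ n x, ‖T n x‖ = ‖x‖) (hsurj : ∀ n, Function.Surjective (T n)) :
    Function.Surjective (lp.mapCLM 2 T hk hT) := by
  intro g
  -- The preimages have the norms of the entries of `g`, so they are square-summable.
  choose f hf using fun n => hsurj n (g n)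
  have hmem : Memℓp f 2 := by
    have h := lp.memℓp g
    rw [memℓp_gen_iff (by norm_num)] at h ⊢
    refine h.congr fun n => ?_
    rw [← hf, hiso]
  refine ⟨⟨f, hmem⟩, lp.ext (funext fun n => ?_)⟩
  rw [lp.mapCLM_apply_coe]
  exact hf n

end Single

/-! ### Unitarity of the CMV factors and their action on the summands. -/

namespace ChoiceSequence

variable {M N : Type*}
  [NormedAddCommGroup M] [InnerProductSpace ℂ M] [CompleteSpace M]
  [NormedAddCommGroup N] [InnerProductSpace ℂ N] [CompleteSpace N]
  (Γ : ChoiceSequence M N)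

lemma norm_J (n : ℕ) (v : WithLp 2 (Γ.X n × Γ.Y (n + 1))) : ‖Γ.J n v‖ = ‖v‖ := by
  refine ((LinearIsometryEquiv.withLpProdCongr 2
    (LinearIsometryEquiv.refl ℂ (Γ.Y n)) (Γ.idX n)).norm_map _).trans ?_
  refine (norm_elementaryRotation _ _ _).trans ?_
  exact (LinearIsometryEquiv.withLpProdCongr 2
    (LinearIsometryEquiv.refl ℂ (Γ.X n)) (Γ.idY n).symm).norm_map v

lemma J_surjective (n : ℕ) : Function.Surjective (Γ.J n) :=
  (LinearIsometryEquiv.withLpProdCongr 2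
    (LinearIsometryEquiv.refl ℂ (Γ.Y n)) (Γ.idX n)).surjective.comp
    ((elementaryRotation_surjective _ _).comp (LinearIsometryEquiv.withLpProdCongr 2
      (LinearIsometryEquiv.refl ℂ (Γ.X n)) (Γ.idY n).symm).surjective)

lemma J_apply (n : ℕ) (v : WithLp 2 (Γ.X n × Γ.Y (n + 1))) :
    Γ.J n v = WithLp.toLp 2
      (Γ.op n v.fst + defectOpFrom (adjoint (Γ.op n)) ((Γ.idY n).symm v.snd),
        Γ.idX n (defectOpTo (Γ.op n) v.fst +
          -adjointDefect (Γ.op n) (Γ.contractive n) ((Γ.idY n).symm v.snd))) := rfl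

lemma opL_apply (v : WithLp 2 (M × Γ.Htilde)) :
    Γ.groupN (Γ.opL v) = lp.mapCLM 2 (fun n => Γ.J (2 * n)) (K := 4) (by norm_num)
      (fun n => Γ.norm_J_le (2 * n)) (Γ.groupM v) :=
  Γ.groupN.apply_symm_apply _

lemma opM_apply (v : WithLp 2 (M × Γ.H)) : Γ.opM v = WithLp.toLp 2 (v.fst, Γ.V v.snd) := rfl

lemma V_surjective : Function.Surjective Γ.V :=
  mapCLM_surjective _ _ _ (fun n => Γ.norm_J (2 * n + 1)) (fun n => Γ.J_surjective (2 * n + 1))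

lemma opL_surjective : Function.Surjective Γ.opL :=
  Γ.groupN.symm.surjective.comp ((mapCLM_surjective _ (by norm_num : (0 : ℝ) ≤ 4)
    (fun n => Γ.norm_J_le (2 * n)) (fun n => Γ.norm_J (2 * n))
    (fun n => Γ.J_surjective (2 * n))).comp Γ.groupM.surjective)

lemma opM_surjective : Function.Surjective Γ.opM := fun w => by
  obtain ⟨h, hh⟩ := Γ.V_surjective w.snd
  exact ⟨WithLp.toLp 2 (w.fst, h), by rw [opM_apply]; exact congrArg (WithLp.toLp 2) (Prod.ext rfl hh)⟩

lemma cmv_surjective : Function.Surjective Γ.cmv := Γ.opL_surjective.comp Γ.opM_surjective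

lemma norm_opM (v : WithLp 2 (M × Γ.H)) : ‖Γ.opM v‖ = ‖v‖ := by
  have hV : ‖Γ.V v.snd‖ = ‖v.snd‖ := norm_mapCLM _ _ _ (fun n => Γ.norm_J (2 * n + 1)) _
  refine (sq_eq_sq₀ (norm_nonneg _) (norm_nonneg _)).1 ?_
  rw [WithLp.prod_norm_sq_eq_of_L2, WithLp.prod_norm_sq_eq_of_L2, opM_apply]
  exact congrArg (fun r : ℝ => ‖v.fst‖ ^ 2 + r ^ 2) hV

/-- The operator `M₀` as an isometric isomorphism. -/
def opMEquiv : WithLp 2 (M × Γ.H) ≃ₗᵢ[ℂ] WithLp 2 (M × Γ.Htilde) :=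
  LinearIsometryEquiv.ofSurjective ⟨Γ.opM.toLinearMap, Γ.norm_opM⟩ Γ.opM_surjective

lemma groupM_left (m : M) : Γ.groupM (WithLp.toLp 2 (m, 0)) =
    lp.single (E := fun n => WithLp 2 (Γ.X (2 * n) × Γ.Y (2 * n + 1))) 2 0
      (WithLp.toLp 2 ((LinearIsometryEquiv.ofTop M (Γ.X 0) Γ.X_zero).symm m, 0)) :=
  regroup_left (A := fun n => Γ.X (2 * n)) (B := fun n => Γ.Y (2 * n + 1)) _

lemma groupN_left (m : N) : Γ.groupN (WithLp.toLp 2 (m, 0)) =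
    lp.single (E := fun n => WithLp 2 (Γ.Y (2 * n) × Γ.X (2 * n + 1))) 2 0
      (WithLp.toLp 2 ((LinearIsometryEquiv.ofTop N (Γ.Y 0) Γ.Y_zero).symm m, 0)) :=
  regroup_left (A := fun n => Γ.Y (2 * n)) (B := fun n => Γ.X (2 * n + 1)) _

lemma groupM_right (n : ℕ) (w : WithLp 2 (Γ.Y (2 * n + 1) × Γ.X (2 * n + 2))) :
    Γ.groupM (WithLp.toLp 2 (0, lp.single 2 n w)) =
      lp.single 2 n (WithLp.toLp 2 (0, w.fst)) +
        lp.single (E := fun n => WithLp 2 (Γ.X (2 * n) × Γ.Y (2 * n + 1))) 2 (n + 1)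
          (WithLp.toLp 2 (w.snd, 0)) := by
  refine Eq.trans ?_ (regroup_right_single (A := fun n => Γ.X (2 * n))
    (B := fun n => Γ.Y (2 * n + 1)) n w)
  exact congrArg (fun a => regroup (fun n => Γ.X (2 * n)) (fun n => Γ.Y (2 * n + 1))
    (WithLp.toLp 2 (a, lp.single 2 n w)))
    (LinearIsometryEquiv.map_zero (LinearIsometryEquiv.ofTop M (Γ.X 0) Γ.X_zero).symm)

lemma groupN_right (n : ℕ) (w : WithLp 2 (Γ.X (2 * n + 1) × Γ.Y (2 * n + 2))) :
    Γ.groupN (WithLp.toLp 2 (0, lp.single 2 n w)) =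
      lp.single 2 n (WithLp.toLp 2 (0, w.fst)) +
        lp.single (E := fun n => WithLp 2 (Γ.Y (2 * n) × Γ.X (2 * n + 1))) 2 (n + 1)
          (WithLp.toLp 2 (w.snd, 0)) := by
  refine Eq.trans ?_ (regroup_right_single (A := fun n => Γ.Y (2 * n))
    (B := fun n => Γ.X (2 * n + 1)) n w)
  exact congrArg (fun a => regroup (fun n => Γ.Y (2 * n)) (fun n => Γ.X (2 * n + 1))
    (WithLp.toLp 2 (a, lp.single 2 n w)))
    (LinearIsometryEquiv.map_zero (LinearIsometryEquiv.ofTop N (Γ.Y 0) Γ.Y_zero).symm)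

lemma groupN_cmv_left (m : M) : Γ.groupN (Γ.cmv (WithLp.toLp 2 (m, 0))) =
    lp.single (E := fun n => WithLp 2 (Γ.Y (2 * n) × Γ.X (2 * n + 1))) 2 0 (Γ.J 0
      (WithLp.toLp 2 ((LinearIsometryEquiv.ofTop M (Γ.X 0) Γ.X_zero).symm m, 0))) := by
  have h : Γ.opM (WithLp.toLp 2 (m, 0)) = WithLp.toLp 2 (m, 0) :=
    congrArg (fun h => WithLp.toLp 2 (m, h)) (map_zero Γ.V)
  change Γ.groupN (Γ.opL (Γ.opM _)) = _
  rw [h, opL_apply, groupM_left]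
  exact mapCLM_single _ _ _ 0 _

/-- M₀ rotates the n-th summand of ℌ₀ by J of odd index; the two output entries fall into
consecutive blocks of L₀, rotated by the neighbouring J of even index. -/
lemma groupN_cmv_right (n : ℕ) (w : WithLp 2 (Γ.X (2 * n + 1) × Γ.Y (2 * n + 2))) :
    Γ.groupN (Γ.cmv (WithLp.toLp 2 (0, lp.single 2 n w))) =
      lp.single 2 n (Γ.J (2 * n) (WithLp.toLp 2 (0, (Γ.J (2 * n + 1) w).fst))) +
        lp.single (E := fun n => WithLp 2 (Γ.Y (2 * n) × Γ.X (2 * n + 1))) 2 (n + 1)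
          (Γ.J (2 * (n + 1)) (WithLp.toLp 2 ((Γ.J (2 * n + 1) w).snd, 0))) := by
  have h : Γ.opM (WithLp.toLp 2 (0, lp.single 2 n w)) =
      WithLp.toLp 2 (0, lp.single 2 n (Γ.J (2 * n + 1) w)) :=
    congrArg (fun h => WithLp.toLp 2 ((0 : M), h))
      (mapCLM_single (fun n => Γ.J (2 * n + 1)) (by norm_num : (0 : ℝ) ≤ 4)
        (fun n => Γ.norm_J_le (2 * n + 1)) n w)
  change Γ.groupN (Γ.opL (Γ.opM _)) = _
  rw [h, opL_apply, groupM_right, map_add]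
  exact congrArg₂ (· + ·) (mapCLM_single (fun n => Γ.J (2 * n)) _ _ n _)
    (mapCLM_single (fun n => Γ.J (2 * n)) _ _ (n + 1) _)

end ChoiceSequence

/-! ### The unitary equivalence -/

section Equivalence

variable {K M N : Type*}
  [NormedAddCommGroup K] [InnerProductSpace ℂ K] [CompleteSpace K]
  [NormedAddCommGroup M] [InnerProductSpace ℂ M] [CompleteSpace M]
  [NormedAddCommGroup N] [InnerProductSpace ℂ N] [CompleteSpace N]

namespace IsChain

variable {Γ : ChoiceSequence M N} {u : K ≃ₗᵢ[ℂ] K} {L : ℕ → Submodule ℂ K}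
  {p : ∀ n, Γ.X n →ₗᵢ[ℂ] K} {q : ∀ n, Γ.Y n →ₗᵢ[ℂ] K}

lemma antitone (h : IsChain Γ u L p q) : Antitone L :=
  antitone_nat_of_succ_le fun n => by rw [h.succ]; exact inf_le_left

lemma map_mem_residual (h : IsChain Γ u L p q) {n : ℕ} {v : K} (hv : v ∈ L (n + 1)) :
    u v ∈ residual (L n) (p n) := by
  rw [h.succ] at hv
  exact ((h.stage n).shift v).1 hv

/-- Each application of u costs one level of the decreasing sequence L. -/
lemma pow_map_mem (h : IsChain Γ u L p q) (n k : ℕ) {v : K} (hv : v ∈ L (n + k)) :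
    (u ^ k) v ∈ L n := by
  induction k generalizing n with
  | zero => simpa using hv
  | succ k ih =>
    rw [pow_succ']
    refine (mem_residual.1 (h.map_mem_residual (ih (n + 1) ?_))).1
    rwa [add_right_comm]

lemma p_mem_succ (h : IsChain Γ u L p q) (n : ℕ) (x : Γ.X (n + 1)) :
    p (n + 1) x ∈ residual (L n) (q n) := by
  rw [← h.succ]; exact (h.stage (n + 1)).p_mem x

lemma rotation (h : IsChain Γ u L p q) (n : ℕ) (v : WithLp 2 (Γ.X n × Γ.Y (n + 1))) :
    q n (Γ.J n v).fst + p (n + 1) (Γ.J n v).snd = p n v.fst + u (q (n + 1) v.snd) := by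
  have := h.rotated n v.fst ((Γ.idY n).symm v.snd)
  rw [LinearIsometryEquiv.apply_symm_apply] at this
  rw [this, Γ.J_apply, sub_eq_add_neg]
  rfl

/-- The embedding of the `n`-th block of the target of `L₀`. -/
def block (h : IsChain Γ u L p q) (n : ℕ) :
    WithLp 2 (Γ.Y (2 * n) × Γ.X (2 * n + 1)) →ₗᵢ[ℂ] K where
  toLinearMap := ((u ^ n).toLinearEquiv : K →ₗ[ℂ] K) ∘ₗ
    ((q (2 * n)).toLinearMap.coprod (p (2 * n + 1)).toLinearMap) ∘ₗ
      (WithLp.linearEquiv 2 ℂ (Γ.Y (2 * n) × Γ.X (2 * n + 1))).toLinearMap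
  norm_map' v := by
    refine ((u ^ n).norm_map _).trans ?_
    change ‖q (2 * n) v.fst + p (2 * n + 1) v.snd‖ = ‖v‖
    refine (sq_eq_sq₀ (norm_nonneg _) (norm_nonneg _)).1 ?_
    rw [WithLp.prod_norm_sq_eq_of_L2, @norm_add_sq ℂ,
      (mem_residual.1 (h.p_mem_succ (2 * n) v.snd)).2]
    simp

lemma block_apply (h : IsChain Γ u L p q) (n : ℕ)
    (v : WithLp 2 (Γ.Y (2 * n) × Γ.X (2 * n + 1))) :
    h.block n v = (u ^ n) (q (2 * n) v.fst + p (2 * n + 1) v.snd) := rfl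

lemma block_J (h : IsChain Γ u L p q) (n : ℕ)
    (v : WithLp 2 (Γ.X (2 * n) × Γ.Y (2 * n + 1))) :
    h.block n (Γ.J (2 * n) v) = (u ^ n) (p (2 * n) v.fst + u (q (2 * n + 1) v.snd)) := by
  rw [block_apply, h.rotation]

/-- For m < n, after removing u^m, the n-th block lies in u L_{2m+2}. This is contained in L_{2m+1}
⊖ ran p_{2m+1}, and L_{2m+1} = L_{2m} ⊖ ran q_{2m}, so both channels of the m-th block are avoided.
-/
lemma orthogonalFamily (h : IsChain Γ u L p q) :
    OrthogonalFamily ℂ (fun n => WithLp 2 (Γ.Y (2 * n) × Γ.X (2 * n + 1))) h.block := by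
  have key : ∀ m n, m < n → ∀ v w, inner ℂ (h.block m v) (h.block n w) = 0 := by
    intro m n hmn v w
    obtain ⟨k, rfl⟩ := Nat.exists_eq_add_of_lt hmn
    set y := q (2 * (m + k + 1)) w.fst + p (2 * (m + k + 1) + 1) w.snd with hy
    have hyL : y ∈ L (2 * (m + k + 1)) := Submodule.add_mem _ ((h.stage _).q_mem _)
      (mem_residual.1 (h.p_mem_succ _ _)).1
    -- The block starts at level 2m + 2 + 2k, and k applications of u use up only k of these levels.
    have h1 : (u ^ k) y ∈ L (2 * m + 1 + 1) :=
      h.pow_map_mem _ k (h.antitone (by omega) hyL)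
    have h2 := h.map_mem_residual h1
    have h3 := (mem_residual.1 h2).1
    rw [h.succ] at h3
    have h4 : h.block (m + k + 1) w = (u ^ m) (u ((u ^ k) y)) := by
      rw [block_apply, ← hy, add_assoc, pow_add, pow_succ']
      rfl
    rw [h4, block_apply, LinearIsometryEquiv.inner_map_map, inner_add_left,
      (mem_residual.1 h2).2, (mem_residual.1 h3).2, add_zero]
  intro m n hmn v w
  rcases lt_or_gt_of_ne hmn with hlt | hlt
  · exact key m n hlt v w
  · rw [← inner_conj_symm, key n m hlt, map_zero]

/-- The embedding `N ⊕ ℌ₀ → K`. -/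
def embedding (h : IsChain Γ u L p q) : WithLp 2 (N × Γ.H) →ₗᵢ[ℂ] K :=
  h.orthogonalFamily.linearIsometry.comp Γ.groupN.toLinearIsometry

lemma embedding_apply (h : IsChain Γ u L p q) (v : WithLp 2 (N × Γ.H)) :
    h.embedding v = h.orthogonalFamily.linearIsometry (Γ.groupN v) := rfl

lemma embedding_left (h : IsChain Γ u L p q) (y : N) :
    h.embedding (WithLp.toLp 2 (y, 0)) =
      q 0 ((LinearIsometryEquiv.ofTop N (Γ.Y 0) Γ.Y_zero).symm y) := by
  rw [embedding_apply, Γ.groupN_left, OrthogonalFamily.linearIsometry_apply_single, block_apply]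
  simp

lemma embedding_right (h : IsChain Γ u L p q) (n : ℕ)
    (w : WithLp 2 (Γ.X (2 * n + 1) × Γ.Y (2 * n + 2))) :
    h.embedding (WithLp.toLp 2 (0, lp.single 2 n w)) =
      (u ^ n) (p (2 * n + 1) w.fst + u (q (2 * n + 2) w.snd)) := by
  rw [embedding_apply, Γ.groupN_right, map_add, OrthogonalFamily.linearIsometry_apply_single,
    OrthogonalFamily.linearIsometry_apply_single, block_apply, block_apply, pow_succ]
  simp
  rfl

lemma embedding_cmv_left (h : IsChain Γ u L p q) (x : M) :
    h.embedding (Γ.cmv (WithLp.toLp 2 (x, 0))) =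
      p 0 ((LinearIsometryEquiv.ofTop M (Γ.X 0) Γ.X_zero).symm x) := by
  rw [embedding_apply, Γ.groupN_cmv_left, OrthogonalFamily.linearIsometry_apply_single]
  refine (h.block_J 0 _).trans ?_
  simp

/-- The even rotations turn the image into u^{n+1}(q_{2n+1} y' + p_{2n+2} x'), where (y', x') =
J_{2n+1} w; the rotation of index 2n+1 then recovers u applied to the embedded w. -/
lemma embedding_cmv_right (h : IsChain Γ u L p q) (n : ℕ)
    (w : WithLp 2 (Γ.X (2 * n + 1) × Γ.Y (2 * n + 2))) :
    h.embedding (Γ.cmv (WithLp.toLp 2 (0, lp.single 2 n w))) =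
      u ((u ^ n) (p (2 * n + 1) w.fst + u (q (2 * n + 2) w.snd))) := by
  rw [embedding_apply, Γ.groupN_cmv_right, map_add, OrthogonalFamily.linearIsometry_apply_single,
    OrthogonalFamily.linearIsometry_apply_single, h.block_J, h.block_J, pow_succ]
  have h1 : ∀ x, u ((u ^ n) x) = (u ^ n) (u x) := fun x =>
    DFunLike.congr_fun (pow_mul_comm' u n).symm x
  rw [h1, ← h.rotation (2 * n + 1) w, map_add u]
  refine Eq.trans ?_ (map_add (u ^ n) _ _).symm
  refine congrArg₂ (fun a b : K => a + b) ?_ ?_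
  · simp
  · change (u ^ n) (u (p (2 * n + 2) _ + u (q (2 * n + 2 + 1) 0))) = _
    simp

end IsChain

variable {Γ : ChoiceSequence M M} {u : K ≃ₗᵢ[ℂ] K} {L : ℕ → Submodule ℂ K}
  {p : ∀ n, Γ.X n →ₗᵢ[ℂ] K} {q : ∀ n, Γ.Y n →ₗᵢ[ℂ] K}

/-- By continuity it suffices to check 𝔐 and the single summands of ℌ₀. On 𝔐 both sides are the
input channel p₀ = u ι. -/
lemma IsChain.embedding_cmv (h : IsChain Γ u L p q) {ι : M →ₗᵢ[ℂ] K} (hp : ∀ x, p 0 x = u (ι x))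
    (hq : ∀ y, q 0 y = ι y) (v : WithLp 2 (M × Γ.H)) :
    h.embedding (Γ.cmv v) = u (h.embedding v) := by
  let A : WithLp 2 (M × Γ.H) →L[ℂ] K := h.embedding.toContinuousLinearMap ∘L Γ.cmv
  let B : WithLp 2 (M × Γ.H) →L[ℂ] K :=
    u.toContinuousLinearEquiv.toContinuousLinearMap ∘L h.embedding.toContinuousLinearMap
  let I : Γ.H →L[ℂ] WithLp 2 (M × Γ.H) :=
    (WithLp.prodContinuousLinearEquiv 2 ℂ M Γ.H).symm.toContinuousLinearMap ∘L
      ContinuousLinearMap.inr ℂ M Γ.H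
  have hleft : ∀ x : M, A (WithLp.toLp 2 (x, 0)) = B (WithLp.toLp 2 (x, 0)) := fun x => by
    change h.embedding (Γ.cmv _) = u (h.embedding _)
    rw [h.embedding_cmv_left, h.embedding_left, hp, hq]
    rfl
  have hright : A ∘L I = B ∘L I := by
    refine lp.ext_continuousLinearMap (by norm_num) fun n => ContinuousLinearMap.ext fun w => ?_
    change h.embedding (Γ.cmv (WithLp.toLp 2 (0, lp.single 2 n w))) =
      u (h.embedding (WithLp.toLp 2 (0, lp.single 2 n w)))
    rw [h.embedding_cmv_right, h.embedding_right]
  have hv : v = WithLp.toLp 2 (v.fst, 0) + I v.snd :=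
    WithLp.ofLp_injective 2 (Prod.ext (add_zero _).symm (zero_add _).symm)
  change A v = B v
  rw [hv, map_add, map_add, hleft]
  exact congrArg _ (DFunLike.congr_fun hright v.snd)

/-- The range of an isometry on a complete space is closed. The intertwining makes it invariant
under U, and surjectivity of `S` makes it invariant under U⁻¹. -/
lemma surjective_of_isCyclicSubspace {U : unitary (K →L[ℂ] K)} {𝔐 : Submodule ℂ K}
    (hcyc : IsCyclicSubspace U 𝔐) {E : Type*} [NormedAddCommGroup E] [InnerProductSpace ℂ E]
    [CompleteSpace E] (W : E →ₗᵢ[ℂ] K) {S : E → E} (hS : Function.Surjective S)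
    (hW : ∀ v, W (S v) = (U : K →L[ℂ] K) (W v)) (h𝔐 : ∀ x ∈ 𝔐, x ∈ Set.range W) :
    Function.Surjective W := by
  have hpos : ∀ x ∈ Set.range W, (U : K →L[ℂ] K) x ∈ Set.range W := by
    rintro _ ⟨v, rfl⟩
    exact ⟨S v, hW v⟩
  have hneg : ∀ x ∈ Set.range W, ((U⁻¹ : unitary (K →L[ℂ] K)) : K →L[ℂ] K) x ∈ Set.range W := by
    rintro _ ⟨v, rfl⟩
    obtain ⟨w, rfl⟩ := hS v
    refine ⟨w, ?_⟩
    rw [hW]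
    exact (DFunLike.congr_fun (congrArg Subtype.val (inv_mul_cancel U)) (W w)).symm
  have hpow : ∀ n : ℤ, ∀ x ∈ Set.range W,
      ((U ^ n : unitary (K →L[ℂ] K)) : K →L[ℂ] K) x ∈ Set.range W := by
    intro n
    induction n with
    | zero => intro x hx; simpa using hx
    | succ n ih =>
      intro x hx
      rw [zpow_add_one]
      exact ih _ (hpos x hx)
    | pred n ih =>
      intro x hx
      rw [zpow_sub_one]
      exact ih _ (hneg x hx)
  have hle : (⨆ n : ℤ, 𝔐.map (((U ^ n : unitary (K →L[ℂ] K)) : K →L[ℂ] K) : K →ₗ[ℂ] K)) ≤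
      W.toLinearMap.range := by
    refine iSup_le fun n => ?_
    rintro _ ⟨x, hx, rfl⟩
    exact hpow n x (h𝔐 x hx)
  have hclosed : IsClosed (W.toLinearMap.range : Set K) := by
    have : (W.toLinearMap.range : Set K) = Set.range W := by ext; simp
    rw [this]
    exact W.isometry.isClosedEmbedding.isClosed_range
  intro x
  have hx : x ∈ (⨆ n : ℤ, 𝔐.map
      (((U ^ n : unitary (K →L[ℂ] K)) : K →L[ℂ] K) : K →ₗ[ℂ] K)).topologicalClosure := by
    rw [hcyc]; trivial
  exact Submodule.topologicalClosure_minimal _ hle hclosed hx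

/-- M₀ is unitary and M₀(L₀M₀) = (M₀L₀)M₀. -/
lemma UnitarilyEquivalent.cmvTilde {A : K →L[ℂ] K} (h : UnitarilyEquivalent A Γ.cmv) :
    UnitarilyEquivalent A Γ.cmvTilde := by
  obtain ⟨W, hW⟩ := h
  exact ⟨W.trans Γ.opMEquiv, fun x => congrArg Γ.opM (hW x)⟩

theorem unitarilyEquivalent_cmv (U : unitary (K →L[ℂ] K)) (𝔐 : Submodule ℂ K) [CompleteSpace 𝔐]
    (hcyc : IsCyclicSubspace U 𝔐) (Γ : ChoiceSequence 𝔐 𝔐)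
    (hΓ : Γ.IsSchurParameters (schurFunction U 𝔐)) :
    UnitarilyEquivalent (U : K →L[ℂ] K) Γ.cmv := by
  obtain ⟨L, p, q, h, hp, hq⟩ := hΓ.exists_isChain (isStage_top (unitaryEquiv U) 𝔐)
    (fun _ hz => schurFunction_eq U 𝔐 hz)
  have hW := h.embedding_cmv (ι := 𝔐.subtypeₗᵢ) hp hq
  have hsurj : Function.Surjective h.embedding :=
    surjective_of_isCyclicSubspace hcyc h.embedding Γ.cmv_surjective hW fun x hx =>
      ⟨WithLp.toLp 2 (⟨x, hx⟩, 0), (h.embedding_left ⟨x, hx⟩).trans (hq _)⟩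
  let e := LinearIsometryEquiv.ofSurjective h.embedding hsurj
  refine ⟨e.symm, fun x => e.injective ?_⟩
  rw [e.apply_symm_apply]
  refine Eq.trans ?_ (hW (e.symm x)).symm
  exact congrArg (U : K →L[ℂ] K) (e.apply_symm_apply x).symm

end Equivalence

end BlockCMV

end

theorem theorem6p5 {K : Type*} [NormedAddCommGroup K] [InnerProductSpace ℂ K] [CompleteSpace K]
    [TopologicalSpace.SeparableSpace K]
    (U : unitary (K →L[ℂ] K)) (𝔐 : Submodule ℂ K) [CompleteSpace 𝔐]
    (hcyc : BlockCMV.IsCyclicSubspace U 𝔐) :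
    (∀ z ∈ Metric.ball (0 : ℂ) 1,
      IsUnit ((U : K →L[ℂ] K) - z • 1) ∧ IsUnit (BlockCMV.caratheodoryAdj U 𝔐 z + 1)) ∧
    BlockCMV.IsSchurClass (BlockCMV.schurFunction U 𝔐) ∧
    (∃ Γ : BlockCMV.ChoiceSequence 𝔐 𝔐, Γ.IsSchurParameters (BlockCMV.schurFunction U 𝔐)) ∧
    ∀ Γ : BlockCMV.ChoiceSequence 𝔐 𝔐, Γ.IsSchurParameters (BlockCMV.schurFunction U 𝔐) →
      BlockCMV.UnitarilyEquivalent (U : K →L[ℂ] K) Γ.cmv ∧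
      BlockCMV.UnitarilyEquivalent (U : K →L[ℂ] K) Γ.cmvTilde :=
  ⟨fun _ hz => ⟨BlockCMV.isUnit_sub_smul U hz, (BlockCMV.caratheodoryAdj_cayley U 𝔐 hz).1⟩,
    BlockCMV.isSchurClass_schurFunction U 𝔐, BlockCMV.exists_isSchurParameters U 𝔐,
    fun Γ hΓ => ⟨BlockCMV.unitarilyEquivalent_cmv U 𝔐 hcyc Γ hΓ,
      (BlockCMV.unitarilyEquivalent_cmv U 𝔐 hcyc Γ hΓ).cmvTilde⟩⟩
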